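/- **Setting.** A tabular episodic two-player zero-sum Markov game has a finite state set $\mathcal S$, $|\mathcal S|=S$, finite nonempty action sets $\mathcal A_{\max},\mathcal A_{\min}$ with $A=|\mathcal A_{\max}\times\mathcal A_{\min}|$, horizon $H\ge 1$, a fixed initial state $s_1$, unknown transition probabilities $\mathbb P_h(\cdot\mid s,\mathbf a)$ and known rewards $r_h(s,\mathbf a)\in[0,1]$. A general policy of a player chooses, at each step $h$, a distribution over her actions as a function of $\tau_h=(s_1,\mathbf a_1,\dots,s_{h-1},\mathbf a_{h-1},s_h)$; it is Markov if this distribution depends only on $(h,s_h)$. $V_1^{\mu\times\nu}(s_1)$ is the expected cumulative reward of the max-player when the players follow $\mu$ and $\nu$ and draw their actions independently. The game is played for $K\ge1$ episodes. In episode $k$ the learner picks a policy $\mu^k$ for the max-player and the opponent picks an arbitrary general policy $\nu^k$ for the min-player, neither seeing the other's choice; $\nu^k$ may depend on everything that happened in the previous episodes (including the learner's policies) and on private randomness of the opponent, independent of the draws of the learner and of the game. A trajectory of $\mu^k\times\nu^k$ is drawn and observed, and $\nu^k$ is revealed at the end of the episode. For a class $\Phi$ of max-player policies, $\mathrm{Regret}_\Phi(k)=\sup_{\mu\in\Phi}\sum_{t=1}^k\big(V_1^{\mu\times\nu^t}-V_1^{\mu^t\times\nu^t}\big)(s_1)$.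 **Algorithm (OP-EXP3).** Parameters: a finite nonempty set $\Phi$ of general max-player policies, $K$, $\delta\in(0,1)$, and constants $a,c>0$. Let $\iota=\log(KHSA/\delta)$, $\beta(t)=H\sqrt{cS\iota/\max\{t,1\}}$ and $\eta_k=a\sqrt{\log|\Phi|/(kH^2)}$. Let $N^k_h(s,\mathbf a)$ and $N_h^k(s,\mathbf a,s')$ count the visits to $(s,\mathbf a)$ and the transitions $(s,\mathbf a)\to s'$ at step $h$ before episode $k$, and let $\hat{\mathbb P}^k_h(s'\mid s,\mathbf a)=N_h^k(s,\mathbf a,s')/N_h^k(s,\mathbf a)$, or $1/S$ if $N_h^k(s,\mathbf a)=0$. For a policy pair $\pi=\mu\times\nu$ define the optimistic value by $\overline V^{k,\pi}_{H+1}\equiv0$ and, for $h=H,\dots,1$, $$\overline V^{k,\pi}_h(\tau_h)=\mathbb E_{\mathbf a\sim\pi(\cdot\mid\tau_h)}\Big[\min\Big\{\mathbb E_{s'\sim\hat{\mathbb P}^k_h(\cdot\mid s_h,\mathbf a)}\big[\overline V^{k,\pi}_{h+1}([\tau_h,\mathbf a,s'])\big]+r_h(s_h,\mathbf a)+\beta(N^k_h(s_h,\mathbf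 a)),\ H-h+1\Big\}\Big].$$ In episode $k$, the algorithm draws $\mu^k\in\Phi$ with probability $\mathbf p^k(\mu)\propto\exp\big(\eta_k\sum_{t=1}^{k-1}\overline V_1^{t,\mu\times\nu^t}(s_1)\big)$. **Theorem.** There is an absolute constant $c_0>0$ such that for all $c\ge c_0$ and $a>0$ there is a constant $C>0$, depending only on $a$ and $c$, such that for every such game, all $K\ge1$, $\delta\in(0,1)$, and every opponent as above, the following hold. 1. For every finite nonempty set $\Phi$ of general max-player policies, OP-EXP3 run with $\Phi$ satisfies, with probability at least $1-\delta$, simultaneously for all $k\le K$, $$\mathrm{Regret}_{\Phi}(k)\le C\Big(\sqrt{H^4S^2A\,k\,\iota^2}+\sqrt{H^2\,k\log|\Phi|}\Big).$$ 2. Let $\Phi^\star$ be the set of all (randomized) Markov policies of the max-player. OP-EXP3 run with the finite set of all deterministic Markov policies satisfies, with probability at least $1-\delta$, simultaneously for all $k\le K$, $$\mathrm{Regret}_{\Phi^\star}(k)\le C\sqrt{H^4S^2A\,k\,\iota^2}.$$ In particular $\mathrm{Regret}_{\Phi^\star}(K)=\tilde{\mathcal O}(\sqrt{H^4S^2AK})$.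 -/

import Mathlib

open MeasureTheory

noncomputable section

namespace MG

/-- A tabular episodic two-player zero-sum Markov game of length `H`, with finite state set `S`,
max-player actions `A` and min-player actions `B`. Steps are numbered `0, …, H - 1`. -/
structure Game (S A B : Type*) (H : ℕ) where
  /-- the fixed initial state -/
  init : S
  /-- transition probabilities: law of the next state -/
  P : Fin H → S → A × B → PMF S
  /-- (expected) rewards of the max-player -/
  r : Fin H → S → A × B → ℝ
  r_mem : ∀ h s a, r h s a ∈ Set.Icc (0 : ℝ) 1

/-- General (history-dependent) policies with actions in `X`: at step `h`, a distribution over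
actions for each sequence of `h` past state-action pairs and each current state. -/
abbrev Policy (S A B : Type*) (H : ℕ) (X : Type*) :=
  (h : Fin H) → (Fin h.val → S × (A × B)) → S → PMF X

abbrev MaxPolicy (S A B : Type*) (H : ℕ) := Policy S A B H A

abbrev MinPolicy (S A B : Type*) (H : ℕ) := Policy S A B H B

/-- A complete trajectory: the state-action pairs of all `H` steps, and the last state. -/
abbrev Traj (S A B : Type*) (H : ℕ) := (Fin H → S × (A × B)) × S

/-- The max-player's policies that look only at the step and at the current state. -/
def markovPolicies (S A B : Type*) (H : ℕ) : Set (MaxPolicy S A B H) :=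
  {μ | ∃ m : Fin H → S → PMF A, μ = fun h _ s => m h s}

open Classical in
/-- The finite class of all deterministic Markov policies of the max-player. -/
def detMarkovPolicies (S A B : Type*) [Fintype S] [Fintype A] (H : ℕ) :
    Finset (MaxPolicy S A B H) :=
  (Finset.univ : Finset (Fin H → S → A)).image fun f h _ s => PMF.pure (f h s)

section Dynamics

variable {S A B : Type*} {H : ℕ}

/-- Law of the complete trajectory when, after the `h` past state-action pairs `τ`, the game is in
state `s` at step `h` and the players follow `μ` and `ν`, drawing their actions independently. -/
def rollout (G : Game S A B H) (μ : MaxPolicy S A B H) (ν : MinPolicy S A B H)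
    (h : ℕ) (τ : Fin h → S × (A × B)) (s : S) : PMF (Traj S A B H) :=
  if hh : h < H then
    (μ ⟨h, hh⟩ τ s).bind fun a =>
      (ν ⟨h, hh⟩ τ s).bind fun b =>
        (G.P ⟨h, hh⟩ s (a, b)).bind fun s' =>
          rollout G μ ν (h + 1) (Fin.snoc (α := fun _ => S × (A × B)) τ (s, (a, b))) s'
  else
    PMF.pure (fun i => τ ⟨i.val, by omega⟩, s)
termination_by H - h

/-- Law of the trajectory of one episode. -/
def trajLaw (G : Game S A B H) (μ : MaxPolicy S A B H) (ν : MinPolicy S A B H) :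
    PMF (Traj S A B H) :=
  rollout G μ ν 0 Fin.elim0 G.init

/-- The value of `μ × ν` at the initial state: the expected cumulative reward of the max-player. -/
def value [Fintype S] [Fintype A] [Fintype B] (G : Game S A B H)
    (μ : MaxPolicy S A B H) (ν : MinPolicy S A B H) : ℝ :=
  ∑ t : Traj S A B H, (trajLaw G μ ν t).toReal * ∑ h : Fin H, G.r h (t.1 h).1 (t.1 h).2

/-- The state reached after the transition of step `h`. -/
def nextState (t : Traj S A B H) (h : Fin H) : S :=
  if hh : h.val + 1 < H then (t.1 ⟨h.val + 1, hh⟩).1 else t.2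

/-- What is known after an episode: the policy of the learner, the revealed policy of the
opponent, and the trajectory. A transcript is a list of these, earliest episode first. -/
structure Episode (S A B : Type*) (H : ℕ) where
  μ : MaxPolicy S A B H
  ν : MinPolicy S A B H
  traj : Traj S A B H

/-- Law of the transcript of the first `K` episodes. In each episode the learner draws its policy
from `learner l` and the opponent plays `opponent l`, where `l` is the transcript so far; neither
sees the other's choice for the current episode. -/
def playLaw (G : Game S A B H) (learner : List (Episode S A B H) → PMF (MaxPolicy S A B H))
    (opponent : List (Episode S A B H) → MinPolicy S A B H) : ℕ → PMF (List (Episode S A B H))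
  | 0 => PMF.pure []
  | K + 1 =>
    (playLaw G learner opponent K).bind fun l =>
      (learner l).bind fun μ =>
        (trajLaw G μ (opponent l)).bind fun t =>
          PMF.pure (l ++ [⟨μ, opponent l, t⟩])

/-- Regret of the transcript `l` against the baseline class `Φ`. The supremum is over a bounded set,
because values lie in `[0, H]`. -/
def regret [Fintype S] [Fintype A] [Fintype B] (G : Game S A B H) (Φ : Set (MaxPolicy S A B H))
    (l : List (Episode S A B H)) : ℝ :=
  sSup ((fun μ => (l.map fun e => value G μ e.ν - value G e.μ e.ν).sum) '' Φ)

end Dynamics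

/-! The algorithm. It has access to the initial state, the rewards and the transcript, but not to
the transition probabilities. -/

section Algorithm

variable {S A B : Type*} {H : ℕ}

open Classical in
/-- Number of visits to the state-action pair `(s, a)` at step `h`. -/
def visits (l : List (Episode S A B H)) (h : Fin H) (s : S) (a : A × B) : ℕ :=
  l.countP fun e => decide (e.traj.1 h = (s, a))

open Classical in
/-- Number of visits to `(s, a)` at step `h` that were followed by a transition to `s'`. -/
def transitions (l : List (Episode S A B H)) (h : Fin H) (s : S) (a : A × B) (s' : S) : ℕ :=
  l.countP fun e => decide (e.traj.1 h = (s, a) ∧ nextState e.traj h = s')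

/-- Empirical transition probabilities, uniform at pairs that were never visited. -/
def empirical [Fintype S] (l : List (Episode S A B H)) (h : Fin H) (s : S) (a : A × B) (s' : S) :
    ℝ :=
  if visits l h s a = 0 then 1 / (Fintype.card S : ℝ)
  else (transitions l h s a s' : ℝ) / (visits l h s a : ℝ)

/-- Optimistic policy evaluation from step `h`, after the past `τ` and in state `s`, for
the policy pair `μ × ν`, with counters from `l` and exploration bonus `β`. -/
def ucbValueFrom [Fintype S] [Fintype A] [Fintype B] (r : Fin H → S → A × B → ℝ) (β : ℕ → ℝ)
    (l : List (Episode S A B H)) (μ : MaxPolicy S A B H) (ν : MinPolicy S A B H)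
    (h : ℕ) (τ : Fin h → S × (A × B)) (s : S) : ℝ :=
  if hh : h < H then
    ∑ a : A, ∑ b : B, (μ ⟨h, hh⟩ τ s a).toReal * (ν ⟨h, hh⟩ τ s b).toReal *
      min ((∑ s' : S, empirical l ⟨h, hh⟩ s (a, b) s' *
              ucbValueFrom r β l μ ν (h + 1)
                (Fin.snoc (α := fun _ => S × (A × B)) τ (s, (a, b))) s')
            + r ⟨h, hh⟩ s (a, b) + β (visits l ⟨h, hh⟩ s (a, b)))
          ((H : ℝ) - h)
  else 0
termination_by H - h

/-- `UCB-VI(N, β, μ × ν)`, where `N` are the counters of the transcript `l`. -/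
def ucbValue [Fintype S] [Fintype A] [Fintype B] (init : S) (r : Fin H → S → A × B → ℝ)
    (β : ℕ → ℝ) (l : List (Episode S A B H)) (μ : MaxPolicy S A B H) (ν : MinPolicy S A B H) : ℝ :=
  ucbValueFrom r β l μ ν 0 Fin.elim0 init

/-- The sum over all past episodes `t` of the optimistic value of `μ` against the opponent's policy
of episode `t`, computed from the counters at the beginning of episode `t`. -/
def cumulativeGain [Fintype S] [Fintype A] [Fintype B] (init : S) (r : Fin H → S → A × B → ℝ)
    (β : ℕ → ℝ) (l : List (Episode S A B H)) (μ : MaxPolicy S A B H) : ℝ :=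
  ∑ t : Fin l.length, ucbValue init r β (l.take t.val) μ (l.get t).ν

/-- Optimistic Policy EXP3. In episode `k = l.length + 1` a policy `μ ∈ Φ` is drawn with
probability proportional to `exp (η k * cumulativeGain μ)`. -/
def opExp3 [Fintype S] [Fintype A] [Fintype B] (init : S) (r : Fin H → S → A × B → ℝ)
    (Φ : Finset (MaxPolicy S A B H)) (hΦ : Φ.Nonempty) (η : ℕ → ℝ) (β : ℕ → ℝ)
    (l : List (Episode S A B H)) : PMF (MaxPolicy S A B H) :=
  (PMF.normalize
    (fun μ : {μ // μ ∈ Φ} =>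
      ENNReal.ofReal (Real.exp (η (l.length + 1) * cumulativeGain init r β l μ.val)))
    (by
      obtain ⟨μ, hμ⟩ := hΦ
      rw [ne_eq, ENNReal.tsum_eq_zero]
      intro h0
      exact absurd (h0 ⟨μ, hμ⟩) (by simp [Real.exp_pos]))
    (by
      rw [tsum_fintype]
      exact ENNReal.sum_ne_top.2 fun _ _ => ENNReal.ofReal_ne_top)).map Subtype.val

/-- The logarithmic factor `log (K H S A / δ)`, with `A` the number of joint actions. -/
def logFactor (S A B : Type*) [Fintype S] [Fintype A] [Fintype B] (H K : ℕ) (δ : ℝ) : ℝ :=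
  Real.log ((K : ℝ) * H * Fintype.card S * Fintype.card (A × B) / δ)

/-- The exploration bonus `β(t) = H √(c S log (K H S A / δ) / max {t, 1})`. -/
def bonus (S A B : Type*) [Fintype S] [Fintype A] [Fintype B] (H K : ℕ) (δ c : ℝ) (t : ℕ) : ℝ :=
  (H : ℝ) * √(c * Fintype.card S * logFactor S A B H K δ / (max t 1 : ℕ))

/-- The anytime learning rate `η_k = a √(log |Φ| / (H² k))`. -/
def rate {S A B : Type*} {H : ℕ} (Φ : Finset (MaxPolicy S A B H)) (a : ℝ) (k : ℕ) : ℝ :=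
  a * √(Real.log Φ.card / ((H : ℝ) ^ 2 * k))

theorem detMarkovPolicies_nonempty (S A B : Type*) [Fintype S] [Fintype A] [Nonempty A] (H : ℕ) :
    (detMarkovPolicies S A B H).Nonempty := by
  classical
  unfold detMarkovPolicies
  exact (Finset.univ_nonempty (α := Fin H → S → A)).image _

/-- Probability that the transcript of the first `K` episodes lies in `E`, when the learner runs
OP-EXP3 over `Φ` (with rate `a` and bonus constant `c`) and the opponent's adaptive
strategy is `opponent ω`, with `ω` a private random seed of law `P₀` which is independent of
the draws of the learner and of the game. -/
def opExp3Prob [Fintype S] [Fintype A] [Fintype B] (G : Game S A B H)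
    (Φ : Finset (MaxPolicy S A B H)) (hΦ : Φ.Nonempty) (K : ℕ) (δ a c : ℝ)
    {Ω : Type*} [MeasurableSpace Ω] (P₀ : Measure Ω)
    (opponent : Ω → List (Episode S A B H) → MinPolicy S A B H)
    (E : Set (List (Episode S A B H))) : ENNReal :=
  ∫⁻ ω, (playLaw G (opExp3 G.init G.r Φ hΦ (rate Φ a) (bonus S A B H K δ c))
    (opponent ω) K).toOuterMeasure E ∂P₀

end Algorithm

end MG

end

/-! Since the opponent's policy is revealed after each episode, the optimistic value of every `μ ∈
Φ` against it can be computed. Choosing among `Φ` is thus an experts problem with full information,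
and exponential weights handle it (`cumulativeGain_le`).

If the empirical transitions are accurate, the optimistic value dominates the true one
(`value_le_ucbValue`) and exceeds it by at most twice the expected bonuses along a trajectory
(`ucbValue_le`). The regret is then at most the sum of three terms (`sum_value_sub_le`): the regret
of exponential weights on the optimistic gains; a martingale, namely the conditional mean of value
plus twice the bonuses, minus its realisation (`playLaw_azuma`); and twice the realised bonuses,
which a pigeonhole count controls (`pathSum_bonus_le`).

Accuracy is needed for continuation values that depend on the history, on the data and on arbitrary
policies, so it is proved for all functions `S → [0, H]` at once. This amounts to controlling the
deviation on every set of states; the `2 ^ S` sets in the union bound account for the factor `S` in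
the bonus (`playLaw_not_isAccurate_le`). All tail bounds come from exponential supermartingales
along the transcript (`expect_exp_pathSum_le_one`).

For Markov baselines, the total value against fixed opponents is affine in the action distribution
at each step and state, so some deterministic Markov policy does at least as well
(`exists_detMarkovPolicy_sum_value_le`); the logarithm of the number of these is absorbed by the
main term.

The argument needs `K H S A ≥ 2`, which keeps the logarithmic factor above `1 / 2`. Otherwise the
max-player has a single action and the regret vanishes. -/

noncomputable section

namespace MG

open scoped ENNReal

/-! ### Expectations and probabilities under a `PMF`. -/

section Expectation

variable {α β : Type*}

/-- Expectation of an extended nonnegative function under a `PMF`. -/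
def expect (p : PMF α) (f : α → ℝ≥0∞) : ℝ≥0∞ := ∑' x, p x * f x

theorem expect_pure (x : α) (f : α → ℝ≥0∞) : expect (PMF.pure x) f = f x := by
  classical
  unfold expect
  rw [tsum_eq_single x]
  · simp
  · intro y hy
    simp [PMF.pure_apply, hy]

theorem expect_bind (p : PMF α) (q : α → PMF β) (f : β → ℝ≥0∞) :
    expect (p.bind q) f = expect p fun x => expect (q x) f := by
  unfold expect
  simp only [PMF.bind_apply, ← ENNReal.tsum_mul_right, ← ENNReal.tsum_mul_left]
  rw [ENNReal.tsum_comm]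
  simp only [mul_assoc]

theorem expect_map (p : PMF α) (g : α → β) (f : β → ℝ≥0∞) :
    expect (p.map g) f = expect p fun x => f (g x) := by
  unfold PMF.map
  rw [expect_bind]
  simp [expect_pure]

theorem expect_mono_support {p : PMF α} {f g : α → ℝ≥0∞} (h : ∀ x ∈ p.support, f x ≤ g x) :
    expect p f ≤ expect p g := by
  refine ENNReal.tsum_le_tsum fun x => ?_
  by_cases hx : p x = 0
  · simp [hx]
  · exact mul_le_mul_right (h x hx) _

theorem expect_congr_support {p : PMF α} {f g : α → ℝ≥0∞} (h : ∀ x ∈ p.support, f x = g x) :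
    expect p f = expect p g :=
  le_antisymm (expect_mono_support fun x hx => (h x hx).le)
    (expect_mono_support fun x hx => (h x hx).ge)

theorem expect_mono {p : PMF α} {f g : α → ℝ≥0∞} (h : ∀ x, f x ≤ g x) :
    expect p f ≤ expect p g :=
  expect_mono_support fun x _ => h x

theorem expect_const (p : PMF α) (c : ℝ≥0∞) : expect p (fun _ => c) = c := by
  simp [expect, ENNReal.tsum_mul_right, p.tsum_coe]

theorem expect_le_of_forall {p : PMF α} {f : α → ℝ≥0∞} {c : ℝ≥0∞} (h : ∀ x, f x ≤ c) :
    expect p f ≤ c :=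
  (expect_mono h).trans (expect_const p c).le

theorem expect_add (p : PMF α) (f g : α → ℝ≥0∞) :
    expect p (fun x => f x + g x) = expect p f + expect p g := by
  simp [expect, mul_add, ENNReal.tsum_add]

theorem expect_const_mul (p : PMF α) (c : ℝ≥0∞) (f : α → ℝ≥0∞) :
    expect p (fun x => c * f x) = c * expect p f := by
  simp only [expect, ← ENNReal.tsum_mul_left]
  exact tsum_congr fun x => by ring

/-- Markov's inequality for `exp f`. -/
theorem toOuterMeasure_le_of_expect_exp_le {p : PMF α} {f : α → ℝ} {E : Set α} {x : ℝ}
    (hp : expect p (fun y => ENNReal.ofReal (Real.exp (f y))) ≤ 1) (hE : ∀ y ∈ E, x ≤ f y) :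
    p.toOuterMeasure E ≤ ENNReal.ofReal (Real.exp (-x)) := by
  have h1 : p.toOuterMeasure E ≤
      expect p fun y => ENNReal.ofReal (Real.exp (-x)) * ENNReal.ofReal (Real.exp (f y)) := by
    rw [PMF.toOuterMeasure_apply]
    refine ENNReal.tsum_le_tsum fun y => ?_
    by_cases hy : y ∈ E
    · rw [Set.indicator_of_mem hy]
      beta_reduce
      rw [← ENNReal.ofReal_mul (Real.exp_pos _).le, ← Real.exp_add]
      refine le_mul_of_one_le_right (zero_le) ?_
      rw [ENNReal.one_le_ofReal]
      exact Real.one_le_exp (by linarith [hE y hy])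
    · rw [Set.indicator_of_notMem hy]
      exact zero_le
  rw [expect_const_mul] at h1
  exact h1.trans (mul_le_of_le_one_right' hp)

theorem toOuterMeasure_add_compl (p : PMF α) (E : Set α) :
    p.toOuterMeasure E + p.toOuterMeasure Eᶜ = 1 := by
  classical
  rw [PMF.toOuterMeasure_apply, PMF.toOuterMeasure_apply, ← ENNReal.tsum_add, ← p.tsum_coe]
  refine tsum_congr fun x => ?_
  by_cases hx : x ∈ E <;> simp [hx]

/-- A discrete law is additive on arbitrary sets, so no measurability enters. Restricting to the
support makes the length and consistency of transcripts available when the good event is analysed.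
-/
theorem one_sub_le_toOuterMeasure {p : PMF α} {E F : Set α} {δ : ℝ} (hδ : 0 ≤ δ)
    (hF : p.toOuterMeasure F ≤ ENNReal.ofReal δ) (h : ∀ x ∈ p.support, x ∉ F → x ∈ E) :
    ENNReal.ofReal (1 - δ) ≤ p.toOuterMeasure E := by
  have h1 : p.toOuterMeasure Eᶜ ≤ p.toOuterMeasure F := by
    rw [← PMF.toOuterMeasure_apply_inter_support]
    refine p.toOuterMeasure.mono fun x hx => ?_
    by_contra hxF
    exact hx.1 (h x hx.2 hxF)
  rw [ENNReal.ofReal_sub _ hδ, ENNReal.ofReal_one, tsub_le_iff_right,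
    ← toOuterMeasure_add_compl p E]
  gcongr
  exact h1.trans hF

/-- Expectation of a real function under a `PMF` on a finite type. -/
def mean [Fintype α] (p : PMF α) (f : α → ℝ) : ℝ := ∑ x, (p x).toReal * f x

theorem sum_toReal [Fintype α] (p : PMF α) : ∑ x, (p x).toReal = 1 := by
  rw [← ENNReal.toReal_sum fun x _ => p.apply_ne_top x, ← tsum_fintype (L := .unconditional α),
    p.tsum_coe, ENNReal.toReal_one]

theorem mean_const [Fintype α] (p : PMF α) (c : ℝ) : mean p (fun _ => c) = c := by
  simp [mean, ← Finset.sum_mul, sum_toReal]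

theorem mean_mono [Fintype α] {p : PMF α} {f g : α → ℝ} (h : ∀ x, f x ≤ g x) :
    mean p f ≤ mean p g :=
  Finset.sum_le_sum fun x _ => mul_le_mul_of_nonneg_left (h x) ENNReal.toReal_nonneg

theorem mean_add [Fintype α] (p : PMF α) (f g : α → ℝ) :
    mean p (fun x => f x + g x) = mean p f + mean p g := by
  simp [mean, mul_add, Finset.sum_add_distrib]

theorem mean_nonneg [Fintype α] {p : PMF α} {f : α → ℝ} (h : ∀ x, 0 ≤ f x) : 0 ≤ mean p f :=
  Finset.sum_nonneg fun x _ => mul_nonneg ENNReal.toReal_nonneg (h x)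

theorem mean_le [Fintype α] {p : PMF α} {f : α → ℝ} {c : ℝ} (h : ∀ x, f x ≤ c) :
    mean p f ≤ c :=
  (mean_mono h).trans (mean_const p c).le

theorem mean_pure [Fintype α] (x : α) (f : α → ℝ) : mean (PMF.pure x) f = f x := by
  classical
  unfold mean
  rw [Finset.sum_eq_single x]
  · simp
  · intro y _ hy
    simp [PMF.pure_apply, hy]
  · simp

theorem mean_bind [Fintype α] [Fintype β] (p : PMF α) (q : α → PMF β) (f : β → ℝ) :
    mean (p.bind q) f = mean p fun x => mean (q x) f := by
  have h (y : β) : ((p.bind q) y).toReal = ∑ x, (p x).toReal * (q x y).toReal := by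
    rw [PMF.bind_apply, tsum_fintype, ENNReal.toReal_sum]
    · simp
    · exact fun x _ => ENNReal.mul_ne_top (p.apply_ne_top x) ((q x).apply_ne_top y)
  simp only [mean, h, Finset.sum_mul, Finset.mul_sum]
  rw [Finset.sum_comm]
  simp only [mul_assoc]

theorem expect_ofReal [Fintype α] (p : PMF α) {f : α → ℝ} (h : ∀ x, 0 ≤ f x) :
    expect p (fun x => ENNReal.ofReal (f x)) = ENNReal.ofReal (mean p f) := by
  unfold expect mean
  rw [tsum_fintype, ENNReal.ofReal_sum_of_nonneg
    fun x _ => mul_nonneg ENNReal.toReal_nonneg (h x)]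
  refine Finset.sum_congr rfl fun x _ => ?_
  rw [ENNReal.ofReal_mul ENNReal.toReal_nonneg, ENNReal.ofReal_toReal (p.apply_ne_top x)]

end Expectation

/-! ### Hoeffding's lemma. -/

section Hoeffding

/-- The chord bound for the exponential on `[-M, M]`. -/
theorem exp_mul_le_cosh_add {M y : ℝ} (hM : 0 < M) (hy : |y| ≤ M) (t : ℝ) :
    Real.exp (t * y) ≤ Real.cosh (t * M) + y / M * Real.sinh (t * M) := by
  obtain ⟨h1, h2⟩ := abs_le.1 hy
  have hu : y / M ≤ 1 := by rw [div_le_one hM]; linarith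
  have hl : -1 ≤ y / M := by rw [le_div_iff₀ hM]; linarith
  have hc := convexOn_exp.2 (Set.mem_univ (t * M)) (Set.mem_univ (-(t * M)))
    (show 0 ≤ (1 + y / M) / 2 by linarith) (show 0 ≤ (1 - y / M) / 2 by linarith) (by ring)
  simp only [smul_eq_mul] at hc
  have h3 : (1 + y / M) / 2 * (t * M) + (1 - y / M) / 2 * -(t * M) = t * y := by
    field_simp
    ring
  rw [h3] at hc
  refine hc.trans (le_of_eq ?_)
  rw [Real.cosh_eq, Real.sinh_eq]
  ring

/-- Hoeffding's lemma for a function with values in `[0, M]`, with a suboptimal constant. -/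
theorem expect_exp_le_one {α : Type*} {p : PMF α} {f : α → ℝ} {M m t : ℝ} (hM : 0 < M)
    (hf : ∀ x, f x ∈ Set.Icc 0 M) (hm : m ∈ Set.Icc 0 M) (ht : 0 ≤ t)
    (hmean : expect p (fun x => ENNReal.ofReal (f x)) ≤ ENNReal.ofReal m) :
    expect p (fun x => ENNReal.ofReal (Real.exp (t * (f x - m) - t ^ 2 * M ^ 2 / 2))) ≤ 1 := by
  set D := Real.exp (-(t ^ 2 * M ^ 2 / 2)) with hD
  have hs : 0 ≤ Real.sinh (t * M) := Real.sinh_nonneg_iff.2 (by positivity)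
  have hcs : Real.sinh (t * M) ≤ Real.cosh (t * M) := (Real.sinh_lt_cosh _).le
  have hmM : m / M ≤ 1 := by rw [div_le_one hM]; exact hm.2
  have hA : 0 ≤ Real.cosh (t * M) - m / M * Real.sinh (t * M) := by nlinarith
  set A := Real.cosh (t * M) - m / M * Real.sinh (t * M) with hAdef
  set B := Real.sinh (t * M) / M with hB
  have hB0 : 0 ≤ B := div_nonneg hs hM.le
  -- The chord bound replaces the exponential by an affine function of `f x` with slope `B ≥ 0`, so
  -- a one-sided bound on the mean suffices.
  have hpt (x : α) : ENNReal.ofReal (Real.exp (t * (f x - m) - t ^ 2 * M ^ 2 / 2)) ≤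
      ENNReal.ofReal D * (ENNReal.ofReal A + ENNReal.ofReal B * ENNReal.ofReal (f x)) := by
    rw [← ENNReal.ofReal_mul hB0, ← ENNReal.ofReal_add hA (mul_nonneg hB0 (hf x).1),
      ← ENNReal.ofReal_mul (Real.exp_pos _).le]
    refine ENNReal.ofReal_le_ofReal ?_
    rw [sub_eq_add_neg, Real.exp_add, mul_comm]
    refine mul_le_mul_of_nonneg_left ?_ (Real.exp_pos _).le
    refine (exp_mul_le_cosh_add hM (y := f x - m) ?_ t).trans (le_of_eq ?_)
    · rw [abs_le]
      constructor <;> linarith [(hf x).1, (hf x).2, hm.1, hm.2]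
    · rw [hAdef, hB]
      ring
  refine (expect_mono hpt).trans ?_
  rw [expect_const_mul, expect_add, expect_const, expect_const_mul]
  calc ENNReal.ofReal D * (ENNReal.ofReal A +
        ENNReal.ofReal B * expect p fun x => ENNReal.ofReal (f x))
      ≤ ENNReal.ofReal D * (ENNReal.ofReal A + ENNReal.ofReal B * ENNReal.ofReal m) := by
        gcongr
    _ = ENNReal.ofReal (D * (A + B * m)) := by
        rw [← ENNReal.ofReal_mul hB0, ← ENNReal.ofReal_add hA (mul_nonneg hB0 hm.1),
          ← ENNReal.ofReal_mul (Real.exp_pos _).le]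
    _ ≤ 1 := by
        rw [ENNReal.ofReal_le_one]
        have h1 : A + B * m = Real.cosh (t * M) := by rw [hAdef, hB]; ring
        rw [h1, hD, Real.exp_neg, inv_mul_le_one₀ (Real.exp_pos _)]
        refine (Real.cosh_le_exp_half_sq _).trans (le_of_eq ?_)
        ring_nf

/-- Hoeffding's lemma for lower deviations. -/
theorem expect_exp_lower_le_one {α : Type*} {p : PMF α} {f : α → ℝ} {M m t : ℝ} (hM : 0 < M)
    (hf : ∀ x, f x ∈ Set.Icc 0 M) (hm : m ∈ Set.Icc 0 M) (ht : 0 ≤ t)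
    (hmean : ENNReal.ofReal m ≤ expect p (fun x => ENNReal.ofReal (f x))) :
    expect p (fun x => ENNReal.ofReal (Real.exp (t * (m - f x) - t ^ 2 * M ^ 2 / 2))) ≤ 1 := by
  -- Reflection `f ↦ M - f` exchanges upper and lower deviations.
  have h := expect_exp_le_one (p := p) (f := fun x => M - f x) (m := M - m) (t := t) hM
    (fun x => ⟨by linarith [(hf x).2], by linarith [(hf x).1]⟩)
    ⟨by linarith [hm.2], by linarith [hm.1]⟩ ht ?_
  · simpa using h
  · have h1 : expect p (fun x => ENNReal.ofReal (M - f x)) +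
        expect p (fun x => ENNReal.ofReal (f x)) = ENNReal.ofReal M := by
      rw [← expect_add, ← expect_const p (ENNReal.ofReal M)]
      congr 1
      funext x
      rw [← ENNReal.ofReal_add (by linarith [(hf x).2]) (hf x).1, sub_add_cancel]
    rw [ENNReal.ofReal_sub _ hm.1, ← h1]
    refine ENNReal.le_sub_of_add_le_right ENNReal.ofReal_ne_top ?_
    gcongr

end Hoeffding

/-! ### Transcripts, path sums and exponential supermartingales. -/

section Transcript

variable {S A B : Type*} {H : ℕ}

/-- Sum over the episodes of a transcript of a function of the episode and of its past. -/
def pathSum (F : List (Episode S A B H) → Episode S A B H → ℝ) (l : List (Episode S A B H)) : ℝ :=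
  ∑ t : Fin l.length, F (l.take t.val) (l.get t)

@[simp]
theorem pathSum_nil (F : List (Episode S A B H) → Episode S A B H → ℝ) : pathSum F [] = 0 := by
  simp [pathSum]

theorem pathSum_concat (F : List (Episode S A B H) → Episode S A B H → ℝ)
    (l : List (Episode S A B H)) (e : Episode S A B H) :
    pathSum F (l ++ [e]) = pathSum F l + F l e := by
  have hlen : (l ++ [e]).length = l.length + 1 := by simp
  unfold pathSum
  rw [← (finCongr hlen.symm).sum_comp, Fin.sum_univ_castSucc]
  congr 1
  · refine Finset.sum_congr rfl fun t _ => ?_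
    simp [List.take_append_of_le_length t.isLt.le]
  · simp

theorem pathSum_add (F F' : List (Episode S A B H) → Episode S A B H → ℝ)
    (l : List (Episode S A B H)) :
    pathSum (fun l e => F l e + F' l e) l = pathSum F l + pathSum F' l := by
  simp [pathSum, Finset.sum_add_distrib]

theorem pathSum_sub (F F' : List (Episode S A B H) → Episode S A B H → ℝ)
    (l : List (Episode S A B H)) :
    pathSum (fun l e => F l e - F' l e) l = pathSum F l - pathSum F' l := by
  simp [pathSum, Finset.sum_sub_distrib]

theorem pathSum_const_mul (c : ℝ) (F : List (Episode S A B H) → Episode S A B H → ℝ)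
    (l : List (Episode S A B H)) :
    pathSum (fun l e => c * F l e) l = c * pathSum F l := by
  simp [pathSum, Finset.mul_sum]

theorem pathSum_const (c : ℝ) (l : List (Episode S A B H)) :
    pathSum (fun _ _ => c) l = l.length * c := by
  simp [pathSum]

theorem pathSum_of_past_free (f : Episode S A B H → ℝ) (l : List (Episode S A B H)) :
    pathSum (fun _ e => f e) l = (l.map f).sum := by
  induction l using List.reverseRecOn with
  | nil => simp
  | append_singleton l e ih => rw [pathSum_concat, ih]; simp

theorem pathSum_le_pathSum {F F' : List (Episode S A B H) → Episode S A B H → ℝ}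
    {l : List (Episode S A B H)}
    (h : ∀ t : Fin l.length, F (l.take t.val) (l.get t) ≤ F' (l.take t.val) (l.get t)) :
    pathSum F l ≤ pathSum F' l :=
  Finset.sum_le_sum fun t _ => h t

/-- Law of the next episode after the transcript `l`. -/
def episodeLaw (G : Game S A B H) (learner : List (Episode S A B H) → PMF (MaxPolicy S A B H))
    (opponent : List (Episode S A B H) → MinPolicy S A B H) (l : List (Episode S A B H)) :
    PMF (Episode S A B H) :=
  (learner l).bind fun μ => (trajLaw G μ (opponent l)).map fun t => ⟨μ, opponent l, t⟩

variable (G : Game S A B H) (learner : List (Episode S A B H) → PMF (MaxPolicy S A B H))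
  (opponent : List (Episode S A B H) → MinPolicy S A B H)

theorem expect_playLaw_succ (K : ℕ) (f : List (Episode S A B H) → ℝ≥0∞) :
    expect (playLaw G learner opponent (K + 1)) f =
      expect (playLaw G learner opponent K) fun l =>
        expect (episodeLaw G learner opponent l) fun e => f (l ++ [e]) := by
  simp only [playLaw, episodeLaw, expect_bind, expect_pure, expect_map]

variable {G learner opponent}

/-- The opponent's policies in the transcript are those prescribed by its strategy. -/
def IsConsistent (opponent : List (Episode S A B H) → MinPolicy S A B H)
    (l : List (Episode S A B H)) : Prop :=
  ∀ t : Fin l.length, (l.get t).ν = opponent (l.take t.val)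

theorem isConsistent_concat {l : List (Episode S A B H)} {e : Episode S A B H}
    (hl : IsConsistent opponent l) (he : e.ν = opponent l) :
    IsConsistent opponent (l ++ [e]) := by
  rintro ⟨t, ht⟩
  rcases Nat.lt_succ_iff_lt_or_eq.1 (show t < l.length + 1 by simpa using ht) with h | h
  · have := hl ⟨t, h⟩
    simpa [List.getElem_append_left h, List.take_append_of_le_length h.le] using this
  · subst h
    simpa using he

theorem IsConsistent.take {l : List (Episode S A B H)} (hl : IsConsistent opponent l) (k : ℕ) :
    IsConsistent opponent (l.take k) := by
  rintro ⟨t, ht⟩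
  have h : t < k ∧ t < l.length := by simpa using ht
  have := hl ⟨t, h.2⟩
  simpa [List.take_take, h.1.le] using this

theorem mem_support_playLaw {K : ℕ} {l : List (Episode S A B H)}
    (hl : l ∈ (playLaw G learner opponent K).support) :
    l.length = K ∧ IsConsistent opponent l := by
  induction K generalizing l with
  | zero =>
    simp only [playLaw, PMF.support_pure, Set.mem_singleton_iff] at hl
    subst hl
    exact ⟨rfl, fun t => t.elim0⟩
  | succ K ih =>
    simp only [playLaw, PMF.mem_support_bind_iff, PMF.support_pure, Set.mem_singleton_iff] at hl
    obtain ⟨l', hl', μ, -, t, -, rfl⟩ := hl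
    obtain ⟨h1, h2⟩ := ih hl'
    exact ⟨by simp [h1], isConsistent_concat h2 rfl⟩

/-- Episodes after the `k`-th integrate out to one. This transfers estimates at time `k` to the law
of the full transcript, where they can be combined by a union bound. -/
theorem expect_playLaw_take {k K : ℕ} (hk : k ≤ K) (f : List (Episode S A B H) → ℝ≥0∞) :
    expect (playLaw G learner opponent K) (fun l => f (l.take k)) =
      expect (playLaw G learner opponent k) f := by
  induction K, hk using Nat.le_induction with
  | base =>
    refine expect_congr_support fun l hl => ?_
    rw [List.take_of_length_le (mem_support_playLaw hl).1.le]
  | succ K hK ih =>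
    rw [expect_playLaw_succ, ← ih]
    refine expect_congr_support fun l hl => ?_
    simp only [List.take_append_of_le_length (hK.trans (mem_support_playLaw hl).1.ge),
      expect_const]

/-- The exponential of a path sum is a supermartingale if each step has conditional mean at most
one. -/
theorem expect_exp_pathSum_le_one {F : List (Episode S A B H) → Episode S A B H → ℝ}
    (hF : ∀ l, expect (episodeLaw G learner opponent l)
      (fun e => ENNReal.ofReal (Real.exp (F l e))) ≤ 1) (K : ℕ) :
    expect (playLaw G learner opponent K) (fun l => ENNReal.ofReal (Real.exp (pathSum F l))) ≤ 1 := by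
  induction K with
  | zero => simp [playLaw, expect_pure]
  | succ K ih =>
    rw [expect_playLaw_succ]
    refine (expect_mono fun l => ?_).trans ih
    simp only [pathSum_concat, Real.exp_add, ENNReal.ofReal_mul (Real.exp_pos _).le]
    rw [expect_const_mul]
    exact mul_le_of_le_one_right' (hF l)

/-- The Chernoff bound for path sums up to time `k`. -/
theorem playLaw_le_pathSum_take_le {F : List (Episode S A B H) → Episode S A B H → ℝ}
    (hF : ∀ l, expect (episodeLaw G learner opponent l)
      (fun e => ENNReal.ofReal (Real.exp (F l e))) ≤ 1) {k K : ℕ} (hk : k ≤ K) (x : ℝ) :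
    (playLaw G learner opponent K).toOuterMeasure {l | x ≤ pathSum F (l.take k)} ≤
      ENNReal.ofReal (Real.exp (-x)) := by
  refine toOuterMeasure_le_of_expect_exp_le (f := fun l => pathSum F (l.take k)) ?_ ?_
  swap
  · exact fun l h => h
  rw [expect_playLaw_take hk (fun l => ENNReal.ofReal (Real.exp (pathSum F l)))]
  exact expect_exp_pathSum_le_one hF k

end Transcript

/-! ### Trajectories, the Markov property and the recursion for returns. -/

section Rollout

variable {S A B : Type*} {H : ℕ}

/-- The state of a trajectory at step `h`; the last state for `h ≥ H`. -/
def stateAt (t : Traj S A B H) (h : ℕ) : S :=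
  if hh : h < H then (t.1 ⟨h, hh⟩).1 else t.2

variable {G : Game S A B H} {μ : MaxPolicy S A B H} {ν : MinPolicy S A B H}

theorem rollout_of_lt {h : ℕ} (hh : h < H) (τ : Fin h → S × (A × B)) (s : S) :
    rollout G μ ν h τ s = (μ ⟨h, hh⟩ τ s).bind fun a => (ν ⟨h, hh⟩ τ s).bind fun b =>
        (G.P ⟨h, hh⟩ s (a, b)).bind fun s' =>
          rollout G μ ν (h + 1) (Fin.snoc (α := fun _ => S × (A × B)) τ (s, (a, b))) s' := by
  rw [rollout, dif_pos hh]

theorem rollout_of_le {h : ℕ} (hh : H ≤ h) (τ : Fin h → S × (A × B)) (s : S) :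
    rollout G μ ν h τ s = PMF.pure (fun i => τ ⟨i.val, by omega⟩, s) := by
  rw [rollout, dif_neg hh.not_gt]

/-- A rollout only appends to the past it starts from. -/
theorem mem_support_rollout {h : ℕ} {τ : Fin h → S × (A × B)} {s : S} {t : Traj S A B H}
    (ht : t ∈ (rollout G μ ν h τ s).support) :
    (∀ i (hi : i < h) (hi' : i < H), t.1 ⟨i, hi'⟩ = τ ⟨i, hi⟩) ∧ stateAt t h = s := by
  induction n : H - h generalizing h s with
  | zero =>
    have hh : H ≤ h := by omega
    rw [rollout_of_le hh, PMF.support_pure, Set.mem_singleton_iff] at ht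
    subst ht
    exact ⟨fun i hi hi' => rfl, by simp [stateAt, hh.not_gt]⟩
  | succ n ih =>
    have hh : h < H := by omega
    rw [rollout_of_lt hh] at ht
    simp only [PMF.mem_support_bind_iff] at ht
    obtain ⟨a, -, b, -, s', -, ht⟩ := ht
    obtain ⟨h1, h2⟩ := ih ht (by omega)
    refine ⟨fun i hi hi' => ?_, ?_⟩
    · rw [h1 i (by omega) hi']
      have : (⟨i, by omega⟩ : Fin (h + 1)) = Fin.castSucc ⟨i, hi⟩ := rfl
      rw [this, Fin.snoc_castSucc (α := fun _ => S × (A × B))]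
    · rw [stateAt, dif_pos hh, h1 h (by omega) hh]
      have : (⟨h, by omega⟩ : Fin (h + 1)) = Fin.last h := rfl
      rw [this, Fin.snoc_last (α := fun _ => S × (A × B))]

theorem stateAction_of_mem_support_rollout {h : ℕ} (hh : h < H) {τ : Fin h → S × (A × B)}
    {x : S × (A × B)} {s' : S} {t : Traj S A B H}
    (ht : t ∈ (rollout G μ ν (h + 1) (Fin.snoc (α := fun _ => S × (A × B)) τ x) s').support) :
    t.1 ⟨h, hh⟩ = x ∧ nextState t ⟨h, hh⟩ = s' := by
  obtain ⟨h1, h2⟩ := mem_support_rollout ht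
  refine ⟨?_, h2⟩
  rw [h1 h (by omega) hh]
  have : (⟨h, by omega⟩ : Fin (h + 1)) = Fin.last h := rfl
  rw [this, Fin.snoc_last (α := fun _ => S × (A × B))]

/-- The Markov property of the transition at step `i`. -/
theorem expect_rollout_transition_le {i : Fin H} {f : S × (A × B) → S → ℝ≥0∞} {c : ℝ≥0∞}
    (hf : ∀ x, expect (G.P i x.1 x.2) (f x) ≤ c) {h : ℕ} (hi : h ≤ i.val)
    (τ : Fin h → S × (A × B)) (s : S) :
    expect (rollout G μ ν h τ s) (fun t => f (t.1 i) (nextState t i)) ≤ c := by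
  induction n : i.val - h generalizing h s with
  | zero =>
    have hh : h = i.val := by omega
    subst hh
    rw [rollout_of_lt i.isLt]
    simp only [expect_bind]
    refine expect_le_of_forall fun a => expect_le_of_forall fun b => ?_
    refine le_trans (le_of_eq ?_) (hf (s, (a, b)))
    congr 1
    funext s'
    -- The remaining rollout cannot alter the transition just drawn, so `f` is constant on its
    -- support.
    rw [← expect_const (rollout G μ ν (i + 1) (Fin.snoc (α := fun _ => S × (A × B)) τ
      (s, (a, b))) s') (f (s, (a, b)) s')]
    refine expect_congr_support fun t ht => ?_
    obtain ⟨h1, h2⟩ := stateAction_of_mem_support_rollout i.isLt ht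
    rw [← h2, ← h1]
  | succ n ih =>
    have hh : h < H := by omega
    rw [rollout_of_lt hh]
    simp only [expect_bind]
    exact expect_le_of_forall fun a => expect_le_of_forall fun b => expect_le_of_forall fun s' =>
      ih (by omega) _ _ (by omega)

variable [Fintype S] [Fintype A] [Fintype B]

variable (G μ ν) in
/-- Expected sum of `ρ` over the steps from `h` on, after the past `τ` and in state `s`. -/
def returnFrom (ρ : Fin H → S → A × B → ℝ) (h : ℕ) (τ : Fin h → S × (A × B)) (s : S) : ℝ :=
  if hh : h < H then
    ∑ a : A, ∑ b : B, (μ ⟨h, hh⟩ τ s a).toReal * (ν ⟨h, hh⟩ τ s b).toReal *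
      ((∑ s' : S, (G.P ⟨h, hh⟩ s (a, b) s').toReal *
        returnFrom ρ (h + 1) (Fin.snoc (α := fun _ => S × (A × B)) τ (s, (a, b))) s')
        + ρ ⟨h, hh⟩ s (a, b))
  else 0
termination_by H - h

theorem returnFrom_of_lt (ρ : Fin H → S → A × B → ℝ) {h : ℕ} (hh : h < H)
    (τ : Fin h → S × (A × B)) (s : S) :
    returnFrom G μ ν ρ h τ s = mean (μ ⟨h, hh⟩ τ s) fun a => mean (ν ⟨h, hh⟩ τ s) fun b =>
      mean (G.P ⟨h, hh⟩ s (a, b)) (fun s' => returnFrom G μ ν ρ (h + 1)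
        (Fin.snoc (α := fun _ => S × (A × B)) τ (s, (a, b))) s') + ρ ⟨h, hh⟩ s (a, b) := by
  rw [returnFrom, dif_pos hh]
  simp only [mean, Finset.mul_sum, mul_assoc]

theorem returnFrom_of_le (ρ : Fin H → S → A × B → ℝ) {h : ℕ} (hh : H ≤ h)
    (τ : Fin h → S × (A × B)) (s : S) : returnFrom G μ ν ρ h τ s = 0 := by
  rw [returnFrom, dif_neg hh.not_gt]

/-- Links the definition of values as trajectory averages with the backward recursion. It is stated
for a general `ρ` because it is applied to rewards and to rewards plus bonuses. -/
theorem mean_rollout (ρ : Fin H → S → A × B → ℝ) {h : ℕ} (hh : h ≤ H)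
    (τ : Fin h → S × (A × B)) (s : S) :
    mean (rollout G μ ν h τ s) (fun t => ∑ i : Fin H, ρ i (t.1 i).1 (t.1 i).2) =
      (∑ i : Fin h, ρ (Fin.castLE hh i) (τ i).1 (τ i).2) + returnFrom G μ ν ρ h τ s := by
  induction n : H - h generalizing h s with
  | zero =>
    have h' : h = H := by omega
    subst h'
    rw [rollout_of_le le_rfl, returnFrom_of_le _ le_rfl, mean_pure, add_zero]
    rfl
  | succ n ih =>
    have h' : h < H := by omega
    rw [rollout_of_lt h', returnFrom_of_lt _ h', mean_bind,
      ← mean_const (μ ⟨h, h'⟩ τ s) (∑ i : Fin h, ρ (Fin.castLE hh i) (τ i).1 (τ i).2), ← mean_add]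
    congr 1
    funext a
    rw [mean_bind, ← mean_const (ν ⟨h, h'⟩ τ s) (∑ i : Fin h, _), ← mean_add]
    congr 1
    funext b
    rw [mean_bind, add_comm (mean _ _), ← add_assoc,
      ← mean_const (G.P ⟨h, h'⟩ s (a, b)) (_ + ρ _ _ _), ← mean_add]
    congr 1
    funext s'
    rw [ih (by omega) _ _ (by omega), Fin.sum_univ_castSucc]
    simp only [Fin.snoc_castSucc (α := fun _ => S × (A × B)),
      Fin.snoc_last (α := fun _ => S × (A × B))]
    rfl

theorem mean_trajLaw (ρ : Fin H → S → A × B → ℝ) :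
    mean (trajLaw G μ ν) (fun t => ∑ i : Fin H, ρ i (t.1 i).1 (t.1 i).2) =
      returnFrom G μ ν ρ 0 Fin.elim0 G.init := by
  rw [trajLaw, mean_rollout ρ (Nat.zero_le H)]
  simp

theorem value_eq_returnFrom :
    value G μ ν = returnFrom G μ ν G.r 0 Fin.elim0 G.init :=
  mean_trajLaw G.r

theorem value_eq_mean :
    value G μ ν = mean (trajLaw G μ ν) fun t => ∑ i : Fin H, G.r i (t.1 i).1 (t.1 i).2 := rfl

theorem value_mem_Icc : value G μ ν ∈ Set.Icc (0 : ℝ) H := by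
  rw [value_eq_mean]
  refine ⟨mean_nonneg fun t => Finset.sum_nonneg fun i _ => (G.r_mem _ _ _).1,
    mean_le fun t => ?_⟩
  calc ∑ i : Fin H, G.r i (t.1 i).1 (t.1 i).2 ≤ ∑ i : Fin H, (1 : ℝ) :=
        Finset.sum_le_sum fun i _ => (G.r_mem _ _ _).2
    _ = H := by simp

theorem returnFrom_mem_Icc {h : ℕ} (hh : h ≤ H) (τ : Fin h → S × (A × B)) (s : S) :
    returnFrom G μ ν G.r h τ s ∈ Set.Icc (0 : ℝ) (H - h) := by
  induction n : H - h generalizing h s with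
  | zero =>
    have h' : h = H := by omega
    subst h'
    rw [returnFrom_of_le _ le_rfl]
    simp
  | succ n ih =>
    have h' : h < H := by omega
    rw [returnFrom_of_lt _ h']
    have key (a : A) (b : B) (s' : S) := ih (show h + 1 ≤ H by omega)
      (Fin.snoc (α := fun _ => S × (A × B)) τ (s, (a, b))) s' (by omega)
    push_cast at key
    constructor
    · exact mean_nonneg fun a => mean_nonneg fun b =>
        add_nonneg (mean_nonneg fun s' => (key a b s').1) (G.r_mem _ _ _).1
    · refine mean_le fun a => mean_le fun b => ?_
      have h1 := mean_le (p := G.P ⟨h, h'⟩ s (a, b)) fun s' => (key a b s').2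
      linarith [(G.r_mem ⟨h, h'⟩ s (a, b)).2]

end Rollout

/-! ### Optimism, and the size of the optimistic excess. -/

section Optimism

variable {S A B : Type*} {H : ℕ} [Fintype S]

theorem empirical_nonneg (l : List (Episode S A B H)) (h : Fin H) (s : S) (a : A × B) (s' : S) :
    0 ≤ empirical l h s a s' := by
  unfold empirical
  split_ifs <;> positivity

/-- The empirical transition probabilities agree with the true ones up to the bonus, when tested
against functions with values in `[0, H]`. -/
def IsAccurate (G : Game S A B H) (β : ℕ → ℝ) (l : List (Episode S A B H)) : Prop :=
  ∀ (h : Fin H) (s : S) (a : A × B) (f : S → ℝ), (∀ s', f s' ∈ Set.Icc (0 : ℝ) H) →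
    |∑ s', empirical l h s a s' * f s' - mean (G.P h s a) f| ≤ β (visits l h s a)

variable [Fintype A] [Fintype B] {G : Game S A B H} {μ : MaxPolicy S A B H}
  {ν : MinPolicy S A B H} {β : ℕ → ℝ} {l : List (Episode S A B H)}

theorem ucbValueFrom_of_lt (r : Fin H → S → A × B → ℝ) {h : ℕ} (hh : h < H)
    (τ : Fin h → S × (A × B)) (s : S) :
    ucbValueFrom r β l μ ν h τ s = mean (μ ⟨h, hh⟩ τ s) fun a => mean (ν ⟨h, hh⟩ τ s) fun b =>
      min ((∑ s' : S, empirical l ⟨h, hh⟩ s (a, b) s' * ucbValueFrom r β l μ ν (h + 1)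
                (Fin.snoc (α := fun _ => S × (A × B)) τ (s, (a, b))) s')
            + r ⟨h, hh⟩ s (a, b) + β (visits l ⟨h, hh⟩ s (a, b))) ((H : ℝ) - h) := by
  rw [ucbValueFrom, dif_pos hh]
  simp only [mean, Finset.mul_sum, mul_assoc]

theorem ucbValueFrom_of_le (r : Fin H → S → A × B → ℝ) {h : ℕ} (hh : H ≤ h)
    (τ : Fin h → S × (A × B)) (s : S) : ucbValueFrom r β l μ ν h τ s = 0 := by
  rw [ucbValueFrom, dif_neg hh.not_gt]

theorem ucbValueFrom_mem_Icc {r : Fin H → S → A × B → ℝ} (hr : ∀ h s a, 0 ≤ r h s a)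
    (hβ : ∀ n, 0 ≤ β n) {h : ℕ} (hh : h ≤ H) (τ : Fin h → S × (A × B)) (s : S) :
    ucbValueFrom r β l μ ν h τ s ∈ Set.Icc (0 : ℝ) (H - h) := by
  have hcast : (h : ℝ) ≤ H := by exact_mod_cast hh
  induction n : H - h generalizing h s with
  | zero =>
    have h' : h = H := by omega
    subst h'
    rw [ucbValueFrom_of_le _ le_rfl]
    simp
  | succ n ih =>
    have h' : h < H := by omega
    rw [ucbValueFrom_of_lt _ h']
    refine ⟨mean_nonneg fun a => mean_nonneg fun b => le_min (add_nonneg (add_nonneg ?_ (hr _ _ _))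
      (hβ _)) (by linarith), mean_le fun a => mean_le fun b => min_le_right _ _⟩
    exact Finset.sum_nonneg fun s' _ => mul_nonneg (empirical_nonneg _ _ _ _ _)
      (ih (show h + 1 ≤ H by omega) _ _ (by exact_mod_cast h') (by omega)).1

theorem ucbValue_mem_Icc {init : S} {r : Fin H → S → A × B → ℝ} (hr : ∀ h s a, 0 ≤ r h s a)
    (hβ : ∀ n, 0 ≤ β n) : ucbValue init r β l μ ν ∈ Set.Icc (0 : ℝ) H := by
  simpa [ucbValue] using ucbValueFrom_mem_Icc (l := l) (μ := μ) (ν := ν) hr hβ (Nat.zero_le H)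
    Fin.elim0 init

/-- Backward induction: accuracy, applied to the true continuation return, lets the bonus pay for
the estimation error. Truncation at `H - h` does no harm because true returns satisfy the same
bound. -/
theorem returnFrom_le_ucbValueFrom (hl : IsAccurate G β l) {h : ℕ}
    (τ : Fin h → S × (A × B)) (s : S) :
    returnFrom G μ ν G.r h τ s ≤ ucbValueFrom G.r β l μ ν h τ s := by
  induction n : H - h generalizing h s with
  | zero => rw [returnFrom_of_le _ (by omega), ucbValueFrom_of_le _ (by omega)]
  | succ n ih =>
    have h' : h < H := by omega
    rw [ucbValueFrom_of_lt _ h', returnFrom_of_lt _ h']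
    refine mean_mono fun a => mean_mono fun b => ?_
    have key := fun s' => returnFrom_mem_Icc (G := G) (μ := μ) (ν := ν)
      (show h + 1 ≤ H by omega) (Fin.snoc (α := fun _ => S × (A × B)) τ (s, (a, b))) s'
    push_cast at key
    have hacc := (abs_le.1 (hl ⟨h, h'⟩ s (a, b) _ fun s' => ⟨(key s').1, (key s').2.trans
      (by linarith [(Nat.cast_nonneg h : (0 : ℝ) ≤ h)])⟩)).1
    have hmono := Finset.sum_le_sum fun s' (_ : s' ∈ Finset.univ) =>
      mul_le_mul_of_nonneg_left (ih (Fin.snoc (α := fun _ => S × (A × B)) τ (s, (a, b))) s'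
        (by omega)) (empirical_nonneg l ⟨h, h'⟩ s (a, b) s')
    have hle := mean_le (p := G.P ⟨h, h'⟩ s (a, b)) fun s' => (key s').2
    refine le_min ?_ ?_
    · linarith
    · linarith [(G.r_mem ⟨h, h'⟩ s (a, b)).2]

theorem value_le_ucbValue (hl : IsAccurate G β l) :
    value G μ ν ≤ ucbValue G.init G.r β l μ ν := by
  rw [value_eq_returnFrom]
  exact returnFrom_le_ucbValueFrom hl _ _

/-- Here accuracy is applied to the optimistic continuation, which depends on the data; truncation
keeps it in `[0, H]`. One `β` is the bonus itself and the other the estimation error, and both are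
then collected under the true dynamics. -/
theorem ucbValueFrom_le_returnFrom (hβ : ∀ n, 0 ≤ β n) (hl : IsAccurate G β l) {h : ℕ}
    (τ : Fin h → S × (A × B)) (s : S) :
    ucbValueFrom G.r β l μ ν h τ s ≤
      returnFrom G μ ν (fun i s a => G.r i s a + 2 * β (visits l i s a)) h τ s := by
  induction n : H - h generalizing h s with
  | zero => rw [returnFrom_of_le _ (by omega), ucbValueFrom_of_le _ (by omega)]
  | succ n ih =>
    have h' : h < H := by omega
    rw [ucbValueFrom_of_lt _ h', returnFrom_of_lt _ h']
    refine mean_mono fun a => mean_mono fun b => (min_le_left _ _).trans ?_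
    have key := fun s' => ucbValueFrom_mem_Icc (μ := μ) (ν := ν) (β := β) (l := l)
      (fun h s a => (G.r_mem h s a).1) hβ
      (show h + 1 ≤ H by omega) (Fin.snoc (α := fun _ => S × (A × B)) τ (s, (a, b))) s'
    push_cast at key
    have hacc := (abs_le.1 (hl ⟨h, h'⟩ s (a, b) _ fun s' => ⟨(key s').1, (key s').2.trans
      (by linarith [(Nat.cast_nonneg h : (0 : ℝ) ≤ h)])⟩)).2
    have hmono := mean_mono (p := G.P ⟨h, h'⟩ s (a, b)) fun s' =>
      ih (Fin.snoc (α := fun _ => S × (A × B)) τ (s, (a, b))) s' (by omega)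
    linarith

theorem ucbValue_le (hβ : ∀ n, 0 ≤ β n) (hl : IsAccurate G β l) :
    ucbValue G.init G.r β l μ ν ≤ value G μ ν +
      mean (trajLaw G μ ν) fun t => 2 * ∑ i : Fin H, β (visits l i (t.1 i).1 (t.1 i).2) := by
  refine (ucbValueFrom_le_returnFrom hβ hl _ _).trans (le_of_eq ?_)
  rw [← mean_trajLaw, value_eq_mean, ← mean_add]
  simp only [Finset.sum_add_distrib, Finset.mul_sum]

end Optimism

/-! ### Transition counts and their exponential moments. -/

section Concentration

variable {S A B : Type*} {H : ℕ}

open Classical in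
theorem visits_concat (l : List (Episode S A B H)) (e : Episode S A B H) (h : Fin H) (s : S)
    (a : A × B) :
    visits (l ++ [e]) h s a = visits l h s a + if e.traj.1 h = (s, a) then 1 else 0 := by
  simp [visits, List.countP_append, List.countP_singleton]

theorem visits_le_length (l : List (Episode S A B H)) (h : Fin H) (s : S) (a : A × B) :
    visits l h s a ≤ l.length := List.countP_le_length

open Classical in
theorem sum_transitions_concat (l : List (Episode S A B H)) (e : Episode S A B H) (h : Fin H)
    (s : S) (a : A × B) (X : Finset S) :
    ∑ s' ∈ X, transitions (l ++ [e]) h s a s' = ∑ s' ∈ X, transitions l h s a s' +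
      if e.traj.1 h = (s, a) ∧ nextState e.traj h ∈ X then 1 else 0 := by
  simp only [transitions, List.countP_append, List.countP_singleton, Finset.sum_add_distrib,
    decide_eq_true_eq]
  congr 1
  by_cases h1 : e.traj.1 h = (s, a) <;> simp [h1]

theorem sum_transitions_univ [Fintype S] (l : List (Episode S A B H)) (h : Fin H) (s : S)
    (a : A × B) : ∑ s', transitions l h s a s' = visits l h s a := by
  classical
  induction l using List.reverseRecOn with
  | nil => simp [transitions, visits]
  | append_singleton l e ih => rw [sum_transitions_concat, visits_concat, ih]; simp

theorem sum_empirical [Fintype S] [Nonempty S] (l : List (Episode S A B H)) (h : Fin H) (s : S)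
    (a : A × B) : ∑ s', empirical l h s a s' = 1 := by
  unfold empirical
  split_ifs with h0
  · simp
  · rw [← Finset.sum_div, ← Nat.cast_sum, sum_transitions_univ, div_self (by exact_mod_cast h0)]

/-- The worst `f` is `M` times the indicator of the set where `p ≥ q`. -/
theorem sum_sub_mul_le [Fintype S] {p q f : S → ℝ} {M ε : ℝ} (hM : 0 ≤ M)
    (hf : ∀ s, f s ∈ Set.Icc 0 M) (h : ∀ X : Finset S, ∑ s ∈ X, (p s - q s) ≤ ε) :
    ∑ s, (p s - q s) * f s ≤ M * ε := by
  classical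
  calc ∑ s, (p s - q s) * f s ≤ ∑ s, if 0 ≤ p s - q s then M * (p s - q s) else 0 := by
        refine Finset.sum_le_sum fun s _ => ?_
        split_ifs with hs
        · rw [mul_comm M]
          exact mul_le_mul_of_nonneg_left (hf s).2 hs
        · exact mul_nonpos_of_nonpos_of_nonneg (not_le.1 hs).le (hf s).1
    _ = M * ∑ s ∈ Finset.univ.filter (fun s => 0 ≤ p s - q s), (p s - q s) := by
        rw [Finset.mul_sum, Finset.sum_filter]
    _ ≤ M * ε := mul_le_mul_of_nonneg_left (h _) hM

/-- Two probability vectors that are close on all sets are close on all bounded functions. -/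
theorem abs_sum_sub_mul_le [Fintype S] {p q f : S → ℝ} {M ε : ℝ} (hM : 0 ≤ M)
    (hf : ∀ s, f s ∈ Set.Icc 0 M) (hp : ∑ s, p s = 1) (hq : ∑ s, q s = 1)
    (h : ∀ X : Finset S, ∑ s ∈ X, (p s - q s) ≤ ε) :
    |∑ s, p s * f s - ∑ s, q s * f s| ≤ M * ε := by
  classical
  -- As both vectors have total mass one, the lower deviation on `X` is the upper deviation on its
  -- complement.
  have h' (X : Finset S) : ∑ s ∈ X, (q s - p s) ≤ ε := by
    have h1 := h Xᶜ
    have h2 : ∑ s, (p s - q s) = 0 := by rw [Finset.sum_sub_distrib, hp, hq, sub_self]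
    rw [← Finset.sum_add_sum_compl X] at h2
    have h3 : ∑ s ∈ X, (q s - p s) = -∑ s ∈ X, (p s - q s) := by
      rw [← Finset.sum_neg_distrib]
      simp
    linarith
  have h1 := sum_sub_mul_le hM hf h
  have h2 := sum_sub_mul_le hM hf h'
  simp only [sub_mul, Finset.sum_sub_distrib] at h1 h2
  rw [abs_le]
  constructor <;> linarith

open Classical in
-- Hoeffding's lemma for the indicator of `X` at the next state. The variance term `ε ^ 2 / 2` is
-- charged only when `(s, a)` is visited at step `i`, so the compensator is proportional to the
-- visits rather than to the number of episodes.
theorem expect_exp_transition_le_one [Fintype S] {G : Game S A B H}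
    {learner : List (Episode S A B H) → PMF (MaxPolicy S A B H)}
    {opponent : List (Episode S A B H) → MinPolicy S A B H} (i : Fin H) (s : S) (a : A × B)
    (X : Finset S) {ε : ℝ} (hε : 0 ≤ ε) (l : List (Episode S A B H)) :
    expect (episodeLaw G learner opponent l) (fun e => ENNReal.ofReal (Real.exp
      (if e.traj.1 i = (s, a) then
        ε * ((if nextState e.traj i ∈ X then 1 else 0) - ∑ s' ∈ X, (G.P i s a s').toReal) - ε ^ 2 / 2
      else 0))) ≤ 1 := by
  unfold episodeLaw
  rw [expect_bind]
  refine expect_le_of_forall fun μ => ?_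
  rw [expect_map]
  refine expect_rollout_transition_le (i := i) (f := fun x s' => ENNReal.ofReal (Real.exp
      (if x = (s, a) then
        ε * ((if s' ∈ X then 1 else 0) - ∑ s' ∈ X, (G.P i s a s').toReal) - ε ^ 2 / 2
      else 0))) ?_ (Nat.zero_le _) _ _
  intro x
  by_cases hx : x = (s, a)
  · subst hx
    simp only [if_true]
    have hm : mean (G.P i s a) (fun s' => if s' ∈ X then 1 else 0) =
        ∑ s' ∈ X, (G.P i s a s').toReal := by
      simp [mean, Finset.sum_ite_mem]
    have h01 (s' : S) : (if s' ∈ X then (1 : ℝ) else 0) ∈ Set.Icc (0 : ℝ) 1 := by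
      split_ifs <;> simp
    have := expect_exp_le_one (p := G.P i s a) (f := fun s' => if s' ∈ X then 1 else 0)
      (m := ∑ s' ∈ X, (G.P i s a s').toReal) (M := 1) (t := ε) one_pos h01
      (by rw [← hm]; exact ⟨mean_nonneg fun s' => (h01 s').1, mean_le fun s' => (h01 s').2⟩) hε
      (by rw [expect_ofReal _ fun s' => (h01 s').1, hm])
    simpa using this
  · simp [hx, expect_const]

open Classical in
theorem pathSum_transition [Fintype S] {G : Game S A B H} (i : Fin H) (s : S) (a : A × B)
    (X : Finset S) (ε : ℝ) (l : List (Episode S A B H)) :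
    pathSum (fun _ e => if e.traj.1 i = (s, a) then
        ε * ((if nextState e.traj i ∈ X then 1 else 0) - ∑ s' ∈ X, (G.P i s a s').toReal) - ε ^ 2 / 2
      else 0) l = ε * ((∑ s' ∈ X, transitions l i s a s' : ℕ) -
        visits l i s a * ∑ s' ∈ X, (G.P i s a s').toReal) - visits l i s a * (ε ^ 2 / 2) := by
  induction l using List.reverseRecOn with
  | nil => simp [transitions, visits]
  | append_singleton l e ih =>
    rw [pathSum_concat, ih, sum_transitions_concat, visits_concat]
    by_cases h1 : e.traj.1 i = (s, a)
    · by_cases h2 : nextState e.traj i ∈ X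
      · simp only [h1, h2, if_true, and_self]
        push_cast
        ring
      · simp only [h1, h2, if_true, if_false, and_false]
        push_cast
        ring
    · simp [h1]

end Concentration

/-! ### The empirical transitions are accurate with high probability. -/

section Accuracy

variable {S A B : Type*} {H : ℕ} [Fintype S]

/-- The transition frequencies out of visited pairs are close to the probabilities on all sets of
states. -/
def IsConcentrated (G : Game S A B H) (x : ℝ) (l : List (Episode S A B H)) : Prop :=
  ∀ (i : Fin H) (s : S) (a : A × B) (X : Finset S), visits l i s a ≠ 0 →
    ∑ s' ∈ X, (empirical l i s a s' - (G.P i s a s').toReal) ≤ √(x / visits l i s a)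

variable {G : Game S A B H} {learner : List (Episode S A B H) → PMF (MaxPolicy S A B H)}
    {opponent : List (Episode S A B H) → MinPolicy S A B H}

/-- The visit count is random, but the parameter `√(x / n)` of the supermartingale must be fixed
beforehand. Hence the count is pinned to `n`; the union over `n` is taken afterwards. -/
theorem playLaw_deviation_le {x : ℝ} (hx : 0 ≤ x) {k K n : ℕ} (hk : k ≤ K) (i : Fin H) (s : S)
    (a : A × B) (X : Finset S) :
    (playLaw G learner opponent K).toOuterMeasure
      {l | n ≠ 0 ∧ visits (l.take k) i s a = n ∧ √(x / n) <
        ∑ s' ∈ X, (empirical (l.take k) i s a s' - (G.P i s a s').toReal)} ≤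
      ENNReal.ofReal (Real.exp (-(x / 2))) := by
  refine le_trans ((playLaw G learner opponent K).toOuterMeasure.mono ?_)
    (playLaw_le_pathSum_take_le (expect_exp_transition_le_one i s a X (Real.sqrt_nonneg (x / n)))
      hk (x / 2))
  rintro l ⟨hn, hv, hl⟩
  show x / 2 ≤ pathSum _ (l.take k)
  rw [pathSum_transition, hv]
  have hn' : (0 : ℝ) < n := by positivity
  have hsq : √(x / n) ^ 2 = x / n := Real.sq_sqrt (by positivity)
  have hemp : (n : ℝ) * ∑ s' ∈ X, (empirical (l.take k) i s a s' - (G.P i s a s').toReal) =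
      (∑ s' ∈ X, transitions (l.take k) i s a s' : ℕ) -
        n * ∑ s' ∈ X, (G.P i s a s').toReal := by
    rw [Finset.sum_sub_distrib, mul_sub]
    congr 1
    simp only [empirical, hv, hn, if_false]
    rw [← Finset.sum_div]
    push_cast
    field_simp
  rw [← hemp, hsq]
  have h1 : √(x / n) * (n * √(x / n)) = x := by
    rw [mul_left_comm, ← sq, hsq]
    field_simp
  have h2 : (n : ℝ) * (x / n / 2) = x / 2 := by field_simp
  have h3 : √(x / n) * (n * √(x / n)) ≤ √(x / n) *
      (n * ∑ s' ∈ X, (empirical (l.take k) i s a s' - (G.P i s a s').toReal)) := by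
    gcongr
  linarith

variable [Fintype A] [Fintype B]

theorem isAccurate_of_isConcentrated {K : ℕ} {δ c : ℝ} {l : List (Episode S A B H)}
    (hι : 0 ≤ logFactor S A B H K δ) (hc : 8 ≤ c)
    (h1 : 1 ≤ c * Fintype.card S * logFactor S A B H K δ)
    (hl : IsConcentrated G (8 * Fintype.card S * logFactor S A B H K δ) l) :
    IsAccurate G (bonus S A B H K δ c) l := by
  intro i s a f hf
  have : Nonempty S := ⟨s⟩
  refine abs_sum_sub_mul_le (Nat.cast_nonneg H) hf (sum_empirical l i s a) (sum_toReal _)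
    fun X => ?_
  rcases Nat.eq_zero_or_pos (visits l i s a) with h0 | hpos
  · rw [h0]
    simp only [zero_le, sup_of_le_right, Nat.cast_one, div_one]
    refine le_trans ?_ (Real.one_le_sqrt.2 h1)
    calc ∑ s' ∈ X, (empirical l i s a s' - (G.P i s a s').toReal)
        ≤ ∑ s' ∈ X, empirical l i s a s' :=
          Finset.sum_le_sum fun s' _ => sub_le_self _ ENNReal.toReal_nonneg
      _ ≤ ∑ s', empirical l i s a s' := Finset.sum_le_univ_sum_of_nonneg
          fun s' => empirical_nonneg _ _ _ _ _
      _ = 1 := sum_empirical l i s a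
  · refine (hl i s a X hpos.ne').trans (Real.sqrt_le_sqrt ?_)
    rw [max_eq_left hpos]
    gcongr

theorem playLaw_not_isConcentrated_le {x : ℝ} (hx : 0 ≤ x) (K : ℕ) :
    (playLaw G learner opponent K).toOuterMeasure
      {l | ∃ k < K, ¬ IsConcentrated G x (l.take k)} ≤
      ENNReal.ofReal ((K * K * H * Fintype.card S * Fintype.card (A × B) * 2 ^ Fintype.card S) *
        Real.exp (-(x / 2))) := by
  -- Union over the time, the visit count, the step, the state-action pair and the set of states.
  -- The count is below `K` because only prefixes of length `k < K` occur.
  let J := Fin K × Fin K × Fin H × S × (A × B) × Finset S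
  have hsub : {l : List (Episode S A B H) | ∃ k < K, ¬ IsConcentrated G x (l.take k)} ⊆
      ⋃ j : J, {l | j.2.1.val ≠ 0 ∧ visits (l.take j.1.val) j.2.2.1 j.2.2.2.1 j.2.2.2.2.1 =
        j.2.1.val ∧ √(x / j.2.1.val) < ∑ s' ∈ j.2.2.2.2.2,
          (empirical (l.take j.1.val) j.2.2.1 j.2.2.2.1 j.2.2.2.2.1 s' -
            (G.P j.2.2.1 j.2.2.2.1 j.2.2.2.2.1 s').toReal)} := by
    rintro l ⟨k, hk, hl⟩
    simp only [IsConcentrated, not_forall, not_le] at hl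
    obtain ⟨i, s, a, X, hv, hlt⟩ := hl
    have hvk : visits (l.take k) i s a < K :=
      (visits_le_length _ _ _ _).trans_lt ((List.length_take_le _ _).trans_lt hk)
    exact Set.mem_iUnion.2 ⟨(⟨k, hk⟩, ⟨_, hvk⟩, i, s, a, X), hv, rfl, hlt⟩
  refine (measure_mono hsub).trans
    ((measure_iUnion_fintype_le _ _).trans ?_)
  refine (Finset.sum_le_sum fun j _ => playLaw_deviation_le hx j.1.isLt.le _ _ _ _).trans
    (le_of_eq ?_)
  rw [Finset.sum_const, nsmul_eq_mul, ENNReal.ofReal_mul (by positivity)]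
  congr 1
  rw [← ENNReal.ofReal_natCast]
  congr 1
  simp only [J, Finset.card_univ, Fintype.card_prod, Fintype.card_fin, Fintype.card_finset]
  push_cast
  ring

theorem exp_neg_logFactor {K : ℕ} {δ : ℝ} (hδ : 0 < δ)
    (hQ : 2 ≤ (K : ℝ) * H * Fintype.card S * Fintype.card (A × B)) :
    Real.exp (-logFactor S A B H K δ) = δ / (K * H * Fintype.card S * Fintype.card (A × B)) := by
  rw [logFactor, Real.exp_neg, Real.exp_log (by positivity), inv_div]

/-- Bounding the logarithmic factor away from zero allows `√ι ≤ 2 ι` and makes the bonus at zero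
visits large enough. -/
theorem half_le_logFactor {K : ℕ} {δ : ℝ} (hδ : 0 < δ) (hδ1 : δ ≤ 1)
    (hQ : 2 ≤ (K : ℝ) * H * Fintype.card S * Fintype.card (A × B)) :
    1 / 2 ≤ logFactor S A B H K δ := by
  have h : Real.log 2 ≤ logFactor S A B H K δ := by
    refine Real.log_le_log (by norm_num) ?_
    rw [le_div_iff₀ hδ]
    nlinarith
  linarith [Real.log_two_gt_d9]

theorem playLaw_not_isAccurate_le [Nonempty S] {K : ℕ} {δ c : ℝ} (hδ : 0 < δ) (hδ1 : δ ≤ 1)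
    (hc : 8 ≤ c) (hQ : 2 ≤ (K : ℝ) * H * Fintype.card S * Fintype.card (A × B)) :
    (playLaw G learner opponent K).toOuterMeasure
      {l | ∃ k < K, ¬ IsAccurate G (bonus S A B H K δ c) (l.take k)} ≤
      ENNReal.ofReal (δ / 2) := by
  have hι := half_le_logFactor hδ hδ1 hQ
  set ι := logFactor S A B H K δ with hιdef
  have hS : (1 : ℝ) ≤ Fintype.card S := by exact_mod_cast Fintype.card_pos
  have h1 : 1 ≤ c * Fintype.card S * ι := by
    have : 1 ≤ c * Fintype.card S := by nlinarith
    nlinarith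
  refine le_trans ((playLaw G learner opponent K).toOuterMeasure.mono ?_)
    ((playLaw_not_isConcentrated_le (x := 8 * Fintype.card S * ι) (by positivity) K).trans
      (ENNReal.ofReal_le_ofReal ?_))
  · rintro l ⟨k, hk, hl⟩
    exact ⟨k, hk, fun h => hl (isAccurate_of_isConcentrated (by linarith) hc h1 h)⟩
  · set Q : ℝ := (K : ℝ) * H * Fintype.card S * Fintype.card (A × B) with hQdef
    have he : Real.exp (-(8 * Fintype.card S * ι / 2)) = (δ / Q) ^ (4 * Fintype.card S) := by
      rw [← exp_neg_logFactor hδ hQ, ← hιdef, ← Real.exp_nat_mul]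
      congr 1
      push_cast
      ring
    have hx0 : 0 ≤ δ / Q := by positivity
    have hx1 : δ / Q ≤ 1 / 2 := by
      rw [div_le_div_iff₀ (by linarith) (by norm_num)]
      linarith
    have hK : (K : ℝ) ≤ Q := by
      have h0 : Q ≠ 0 := by linarith
      have hH : H ≠ 0 := by rintro rfl; simp [hQdef] at h0
      have hA : Fintype.card (A × B) ≠ 0 := by
        intro h; rw [hQdef, h] at h0; simp at h0
      have : K ≤ K * H * Fintype.card S * Fintype.card (A × B) := by
        rw [mul_assoc, mul_assoc]
        exact Nat.le_mul_of_pos_right _ (Nat.pos_of_ne_zero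
          (by have := Fintype.card_ne_zero (α := S); positivity))
      rw [hQdef]
      exact_mod_cast this
    rw [he]
    -- Of the `4 S` factors `δ / Q`, `S` cancel the `2 ^ S` subsets; three of the others cover the
    -- remaining count `K * Q ≤ Q * Q` and leave `δ / 2`.
    have hp : (δ / Q) ^ (4 * Fintype.card S) =
        (δ / Q) ^ Fintype.card S * (δ / Q) ^ (3 * Fintype.card S) := by
      rw [← pow_add]; congr 1; ring
    have h2S : (2 : ℝ) ^ Fintype.card S * (δ / Q) ^ Fintype.card S ≤ 1 := by
      rw [← mul_pow]
      exact pow_le_one₀ (by positivity) (by linarith)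
    have h3S : (δ / Q) ^ (3 * Fintype.card S) ≤ (δ / Q) ^ 3 :=
      pow_le_pow_of_le_one hx0 (by linarith) (by have := Fintype.card_pos (α := S); omega)
    calc (K * K * H * Fintype.card S * Fintype.card (A × B) * 2 ^ Fintype.card S : ℝ) *
          (δ / Q) ^ (4 * Fintype.card S)
        = (K * Q) * (2 ^ Fintype.card S * (δ / Q) ^ Fintype.card S) *
            (δ / Q) ^ (3 * Fintype.card S) := by rw [hp, hQdef]; ring
      _ ≤ (Q * Q) * 1 * (δ / Q) ^ 3 := by gcongr
      _ = δ * (δ * (δ / Q)) := by field_simp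
      _ ≤ δ * (1 * (1 / 2)) := by gcongr
      _ = δ / 2 := by ring

end Accuracy

/-! ### Exponential weights with a varying learning rate. -/

section Hedge

variable {ι : Type*} [Fintype ι]

/-- The exponential weights with learning rate `η` for the cumulative gains `G`. -/
def expWeight (η : ℝ) (G : ι → ℝ) (i : ι) : ℝ :=
  Real.exp (η * G i) / ∑ j, Real.exp (η * G j)

/-- The logarithmic potential of the exponential weights algorithm. -/
def logPotential (η : ℝ) (G : ι → ℝ) : ℝ :=
  Real.log (∑ i, (Fintype.card ι : ℝ)⁻¹ * Real.exp (η * G i)) / η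

theorem logPotential_zero (η : ℝ) [Nonempty ι] : logPotential η (fun _ : ι => 0) = 0 := by
  simp [logPotential]

theorem sum_exp_pos [Nonempty ι] (η : ℝ) (G : ι → ℝ) : 0 < ∑ i, Real.exp (η * G i) :=
  Finset.sum_pos (fun _ _ => Real.exp_pos _) Finset.univ_nonempty

theorem sum_expWeight [Nonempty ι] (η : ℝ) (G : ι → ℝ) : ∑ i, expWeight η G i = 1 := by
  unfold expWeight
  rw [← Finset.sum_div, div_self (sum_exp_pos η G).ne']

theorem expWeight_nonneg (η : ℝ) (G : ι → ℝ) (i : ι) : 0 ≤ expWeight η G i :=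
  div_nonneg (Real.exp_pos _).le (Finset.sum_nonneg fun _ _ => (Real.exp_pos _).le)

/-- The power mean inequality with exponent `η / η'`. Normalising by the uniform weights and
dividing by `η` makes a decrease of the learning rate free of charge. -/
theorem logPotential_mono [Nonempty ι] {η η' : ℝ} (h0 : 0 < η') (h : η' ≤ η) (G : ι → ℝ) :
    logPotential η' G ≤ logPotential η G := by
  have hN : (0 : ℝ) < (Fintype.card ι : ℝ)⁻¹ := by
    have := Fintype.card_pos (α := ι); positivity
  have hη : 0 < η := h0.trans_le h
  have hpos (θ : ℝ) : 0 < ∑ i, (Fintype.card ι : ℝ)⁻¹ * Real.exp (θ * G i) := by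
    rw [← Finset.mul_sum]
    exact mul_pos hN (sum_exp_pos _ _)
  have key := Real.rpow_arith_mean_le_arith_mean_rpow Finset.univ
    (fun _ : ι => (Fintype.card ι : ℝ)⁻¹) (fun i => Real.exp (η' * G i)) (fun _ _ => hN.le)
    (by simp) (fun _ _ => (Real.exp_pos _).le) (p := η / η') (by rwa [one_le_div h0])
  simp only [← Real.exp_mul] at key
  have h1 (i : ι) : η' * G i * (η / η') = η * G i := by field_simp
  simp only [h1] at key
  have h2 := Real.log_le_log (Real.rpow_pos_of_pos (hpos η') _) key
  rw [Real.log_rpow (hpos η')] at h2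
  unfold logPotential
  rw [div_le_div_iff₀ h0 hη]
  have h3 := mul_le_mul_of_nonneg_right h2 h0.le
  have h4 : η / η' * Real.log (∑ i, (Fintype.card ι : ℝ)⁻¹ * Real.exp (η' * G i)) * η' =
      Real.log (∑ i, (Fintype.card ι : ℝ)⁻¹ * Real.exp (η' * G i)) * η := by field_simp
  linarith

/-- The potential grows by the log-moment generating function of `g` under the current weights,
divided by `η`; the chord bound, as in Hoeffding's lemma, estimates it. -/
theorem logPotential_add_le [Nonempty ι] {η M : ℝ} (hη : 0 < η) (hM : 0 < M) (G g : ι → ℝ)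
    (hg : ∀ i, g i ∈ Set.Icc 0 M) :
    logPotential η (fun i => G i + g i) ≤
      logPotential η G + ∑ i, expWeight η G i * g i + η * M ^ 2 / 2 := by
  set Z := ∑ i, Real.exp (η * G i) with hZ
  have hZ0 : 0 < Z := sum_exp_pos η G
  have hN : (0 : ℝ) < (Fintype.card ι : ℝ)⁻¹ := by
    have := Fintype.card_pos (α := ι); positivity
  set m := ∑ i, expWeight η G i * g i with hm
  have hm0 : 0 ≤ m := Finset.sum_nonneg fun i _ => mul_nonneg (expWeight_nonneg _ _ _) (hg i).1
  have hmM : m ≤ M := by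
    calc m ≤ ∑ i, expWeight η G i * M :=
          Finset.sum_le_sum fun i _ => mul_le_mul_of_nonneg_left (hg i).2 (expWeight_nonneg _ _ _)
      _ = M := by rw [← Finset.sum_mul, sum_expWeight, one_mul]
  have hW : ∑ i, expWeight η G i * Real.exp (η * g i) ≤ Real.exp (η * m + η ^ 2 * M ^ 2 / 2) := by
    have hpt (i : ι) : expWeight η G i * Real.exp (η * g i) ≤
        Real.exp (η * m) * (expWeight η G i * Real.cosh (η * M) +
          (expWeight η G i * g i - expWeight η G i * m) * (Real.sinh (η * M) / M)) := by
      have h := exp_mul_le_cosh_add hM (y := g i - m)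
        (by rw [abs_le]; constructor <;> linarith [(hg i).1, (hg i).2]) η
      have h1 : Real.exp (η * g i) = Real.exp (η * m) * Real.exp (η * (g i - m)) := by
        rw [← Real.exp_add]; ring_nf
      rw [h1]
      calc expWeight η G i * (Real.exp (η * m) * Real.exp (η * (g i - m)))
          = (expWeight η G i * Real.exp (η * m)) * Real.exp (η * (g i - m)) := by ring
        _ ≤ (expWeight η G i * Real.exp (η * m)) *
            (Real.cosh (η * M) + (g i - m) / M * Real.sinh (η * M)) :=
          mul_le_mul_of_nonneg_left h
            (mul_nonneg (expWeight_nonneg _ _ _) (Real.exp_pos _).le)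
        _ = _ := by ring
    refine (Finset.sum_le_sum fun i _ => hpt i).trans ?_
    rw [← Finset.mul_sum, Finset.sum_add_distrib, ← Finset.sum_mul, ← Finset.sum_mul,
      Finset.sum_sub_distrib, ← Finset.sum_mul, sum_expWeight, Real.exp_add, ← hm]
    refine mul_le_mul_of_nonneg_left ?_ (Real.exp_pos _).le
    have := Real.cosh_le_exp_half_sq (η * M)
    rw [mul_pow] at this
    linarith
  have hsplit : ∑ i, (Fintype.card ι : ℝ)⁻¹ * Real.exp (η * (G i + g i)) =
      (∑ i, (Fintype.card ι : ℝ)⁻¹ * Real.exp (η * G i)) *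
        ∑ i, expWeight η G i * Real.exp (η * g i) := by
    simp only [← Finset.mul_sum, expWeight, ← hZ, div_mul_eq_mul_div, ← Finset.sum_div, mul_add,
      Real.exp_add]
    field_simp
  have hP : 0 < ∑ i, (Fintype.card ι : ℝ)⁻¹ * Real.exp (η * G i) := by
    rw [← Finset.mul_sum]
    exact mul_pos hN hZ0
  have hWpos : 0 < ∑ i, expWeight η G i * Real.exp (η * g i) :=
    Finset.sum_pos (fun i _ => mul_pos (div_pos (Real.exp_pos _) hZ0) (Real.exp_pos _))
      Finset.univ_nonempty
  unfold logPotential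
  rw [hsplit, Real.log_mul hP.ne' hWpos.ne', add_div, add_assoc]
  refine add_le_add le_rfl ?_
  rw [div_le_iff₀ hη]
  calc Real.log (∑ i, expWeight η G i * Real.exp (η * g i))
      ≤ η * m + η ^ 2 * M ^ 2 / 2 := by
        rw [← Real.log_exp (η * m + η ^ 2 * M ^ 2 / 2)]
        exact Real.log_le_log hWpos hW
    _ = (m + η * M ^ 2 / 2) * η := by ring

/-- A sum of exponentials dominates each term; the logarithm is the price of the uniform weights. -/
theorem le_logPotential [Nonempty ι] {η : ℝ} (hη : 0 < η) (G : ι → ℝ) (i : ι) :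
    G i ≤ logPotential η G + Real.log (Fintype.card ι) / η := by
  have hN : (0 : ℝ) < Fintype.card ι := by exact_mod_cast Fintype.card_pos
  unfold logPotential
  rw [← add_div, le_div_iff₀ hη, ← Finset.mul_sum,
    Real.log_mul (by positivity) (sum_exp_pos η G).ne', Real.log_inv]
  have h : Real.exp (η * G i) ≤ ∑ j, Real.exp (η * G j) :=
    Finset.single_le_sum (f := fun j => Real.exp (η * G j))
      (fun _ _ => (Real.exp_pos _).le) (Finset.mem_univ i)
  have := Real.log_le_log (Real.exp_pos _) h
  rw [Real.log_exp] at this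
  linarith

end Hedge

/-! ### The regret of the algorithm on the optimistic gains. -/

section ExpThree

variable {S A B : Type*} {H : ℕ} [Fintype S] [Fintype A] [Fintype B]
  {init : S} {r : Fin H → S → A × B → ℝ} {Φ : Finset (MaxPolicy S A B H)} {hΦ : Φ.Nonempty}
  {η : ℕ → ℝ} {β : ℕ → ℝ}

theorem expect_opExp3 (l : List (Episode S A B H)) (f : MaxPolicy S A B H → ℝ≥0∞) :
    expect (opExp3 init r Φ hΦ η β l) f = ∑ μ : Φ, ENNReal.ofReal (expWeight (η (l.length + 1))
      (fun μ : Φ => cumulativeGain init r β l μ) μ) * f μ := by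
  have : Nonempty Φ := hΦ.to_subtype
  unfold opExp3
  rw [expect_map]
  unfold expect
  rw [tsum_fintype]
  refine Finset.sum_congr rfl fun μ _ => ?_
  congr 1
  rw [PMF.normalize_apply, tsum_fintype, ← ENNReal.ofReal_sum_of_nonneg
    fun _ _ => (Real.exp_pos _).le, ← div_eq_mul_inv, expWeight,
    ENNReal.ofReal_div_of_pos (sum_exp_pos _ _)]

theorem cumulativeGain_concat (l : List (Episode S A B H)) (e : Episode S A B H)
    (μ : MaxPolicy S A B H) :
    cumulativeGain init r β (l ++ [e]) μ =
      cumulativeGain init r β l μ + ucbValue init r β l μ e.ν :=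
  pathSum_concat (fun l e => ucbValue init r β l μ e.ν) l e

variable (init r Φ η β) in
/-- The mean optimistic value of the policies of `Φ` against `e.ν`, under the weights after `l`. -/
def weightedGain (l : List (Episode S A B H)) (e : Episode S A B H) : ℝ :=
  ∑ μ : Φ, expWeight (η (l.length + 1)) (fun μ : Φ => cumulativeGain init r β l μ) μ *
    ucbValue init r β l μ e.ν

theorem logPotential_cumulativeGain_le (hΦ : Φ.Nonempty) (hr : ∀ h s a, 0 ≤ r h s a)
    (hβ : ∀ n, 0 ≤ β n) (hH : 0 < H) (hη : ∀ n, 0 < η (n + 1)) (hmono : ∀ n, η (n + 2) ≤ η (n + 1))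
    (l : List (Episode S A B H)) :
    logPotential (η (l.length + 1)) (fun μ : Φ => cumulativeGain init r β l μ) ≤
      pathSum (weightedGain init r Φ η β) l +
        ∑ t ∈ Finset.range l.length, η (t + 1) * (H : ℝ) ^ 2 / 2 := by
  have : Nonempty Φ := hΦ.to_subtype
  induction l using List.reverseRecOn with
  | nil => simp [cumulativeGain, logPotential_zero]
  | append_singleton l e ih =>
    rw [pathSum_concat, List.length_append, List.length_singleton, Finset.sum_range_succ]
    -- First return from the next rate to the one used in the last episode, then add that episode's
    -- gain.
    refine (logPotential_mono (hη _) (hmono _) _).trans ?_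
    simp only [cumulativeGain_concat]
    refine (logPotential_add_le (hη _) (M := H) (by exact_mod_cast hH) _ _
      fun μ => ucbValue_mem_Icc hr hβ).trans ?_
    unfold weightedGain at ih ⊢
    linarith

theorem sum_inv_sqrt_le (k : ℕ) :
    ∑ t ∈ Finset.range k, 1 / √((t : ℝ) + 1) ≤ 2 * √k := by
  induction k with
  | zero => simp
  | succ k ih =>
    rw [Finset.sum_range_succ]
    push_cast
    have h0 : (0 : ℝ) ≤ k := Nat.cast_nonneg k
    have hb : 0 < √((k : ℝ) + 1) := Real.sqrt_pos.2 (by linarith)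
    have h1 : 1 / √((k : ℝ) + 1) ≤ 2 * √((k : ℝ) + 1) - 2 * √k := by
      rw [div_le_iff₀ hb]
      nlinarith [Real.sq_sqrt h0, Real.sq_sqrt (show (0 : ℝ) ≤ k + 1 by linarith),
        sq_nonneg (√((k : ℝ) + 1) - √k)]
    linarith

/-- The regret bound of exponential weights with an anytime learning rate. -/
theorem cumulativeGain_le (hΦ : Φ.Nonempty) (hr : ∀ h s a, 0 ≤ r h s a) (hβ : ∀ n, 0 ≤ β n)
    (hH : 0 < H) {a : ℝ} (ha : 0 < a) (l : List (Episode S A B H)) {μ : MaxPolicy S A B H}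
    (hμ : μ ∈ Φ) :
    cumulativeGain init r β l μ ≤ pathSum (weightedGain init r Φ (rate Φ a) β) l +
      (2 / a + a) * √((H : ℝ) ^ 2 * Real.log Φ.card * l.length) := by
  have hne : Nonempty Φ := hΦ.to_subtype
  have hH' : (0 : ℝ) < H := by exact_mod_cast hH
  rcases Nat.eq_zero_or_pos l.length with h0 | hk
  · obtain rfl := List.length_eq_zero_iff.1 h0
    simp [cumulativeGain]
  -- For a single policy the rate is zero and the potential degenerates; there the weighted gain is
  -- the gain itself.
  rcases (Nat.one_le_iff_ne_zero.2 hΦ.card_pos.ne').eq_or_lt with h1 | h1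
  · obtain ⟨μ', hμ'⟩ := Finset.card_eq_one.1 h1.symm
    subst hμ'
    obtain rfl := Finset.mem_singleton.1 hμ
    simp only [Finset.card_singleton, Nat.cast_one, Real.log_one, mul_zero, zero_mul,
      Real.sqrt_zero, add_zero]
    refine le_of_eq ?_
    show pathSum (fun l e => ucbValue init r β l μ e.ν) l = _
    congr 1
    funext l e
    simp [weightedGain, expWeight]
  set N := Real.log Φ.card with hN
  have hN0 : 0 < N := Real.log_pos (by exact_mod_cast h1)
  have hrate (n : ℕ) : rate Φ a (n + 1) = a * √N / H * (1 / √((n : ℝ) + 1)) := by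
    unfold rate
    rw [← hN, Real.sqrt_div hN0.le, Real.sqrt_mul (sq_nonneg _), Real.sqrt_sq hH'.le]
    push_cast
    field_simp
  have hsq (n : ℕ) : 0 < √((n : ℝ) + 1) := Real.sqrt_pos.2 (by positivity)
  have hsN : 0 < √N := Real.sqrt_pos.2 hN0
  have hη (n : ℕ) : 0 < rate Φ a (n + 1) := by
    rw [hrate]
    have := hsq n
    positivity
  have hmono (n : ℕ) : rate Φ a (n + 2) ≤ rate Φ a (n + 1) := by
    rw [hrate, hrate n]
    have := hsq n
    push_cast
    gcongr
    linarith
  have hpot := logPotential_cumulativeGain_le (init := init) (hΦ := hΦ) hr hβ hH hη hmono l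
  have hle := le_logPotential (hη l.length)
    (fun μ : Φ => cumulativeGain init r β l μ) ⟨μ, hμ⟩
  rw [Fintype.card_coe, ← hN] at hle
  have hR : √((H : ℝ) ^ 2 * N * l.length) = H * √N * √l.length := by
    rw [Real.sqrt_mul (by positivity), Real.sqrt_mul (by positivity), Real.sqrt_sq hH'.le]
  have hone : N / rate Φ a (l.length + 1) ≤ 2 / a * √((H : ℝ) ^ 2 * N * l.length) := by
    rw [hR, hrate]
    -- The final potential uses the rate of the episode after the transcript, hence the shift by
    -- one; the transcript is nonempty here.
    have h2 : √((l.length : ℝ) + 1) ≤ 2 * √l.length := by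
      rw [Real.sqrt_le_left (by positivity), mul_pow, Real.sq_sqrt (by positivity)]
      have : (1 : ℝ) ≤ l.length := by exact_mod_cast hk
      linarith
    have h3 : N / (a * √N / H * (1 / √((l.length : ℝ) + 1))) =
        H * √N / a * √((l.length : ℝ) + 1) := by
      have := hsq l.length
      nth_rewrite 1 [← Real.mul_self_sqrt hN0.le]
      field_simp
    rw [h3]
    calc H * √N / a * √((l.length : ℝ) + 1) ≤ H * √N / a * (2 * √l.length) := by gcongr
      _ = _ := by ring
  have htwo : ∑ t ∈ Finset.range l.length, rate Φ a (t + 1) * (H : ℝ) ^ 2 / 2 ≤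
      a * √((H : ℝ) ^ 2 * N * l.length) := by
    have h4 : ∑ t ∈ Finset.range l.length, rate Φ a (t + 1) * (H : ℝ) ^ 2 / 2 =
        a * √N * H / 2 * ∑ t ∈ Finset.range l.length, 1 / √((t : ℝ) + 1) := by
      rw [Finset.mul_sum]
      refine Finset.sum_congr rfl fun t _ => ?_
      have := hsq t
      rw [hrate]
      field_simp
    rw [h4, hR]
    calc a * √N * H / 2 * ∑ t ∈ Finset.range l.length, 1 / √((t : ℝ) + 1)
        ≤ a * √N * H / 2 * (2 * √l.length) := by
          gcongr
          exact sum_inv_sqrt_le _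
      _ = _ := by ring
  linarith

end ExpThree

/-! ### The sum of the collected bonuses. -/

section Pigeonhole

variable {S A B : Type*} {H : ℕ} [Fintype S] [Fintype A] [Fintype B]

theorem sum_visits (l : List (Episode S A B H)) (i : Fin H) :
    ∑ x : S × (A × B), visits l i x.1 x.2 = l.length := by
  classical
  induction l using List.reverseRecOn with
  | nil => simp [visits]
  | append_singleton l e ih =>
    simp only [visits_concat, Finset.sum_add_distrib, ih]
    simp

/-- A telescoping majorant. The constant `3` leaves room for `√(n + 1) ≤ 2 √n` when `n ≥ 1`, and the
case `n = 0` reads `1 ≤ 3`. -/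
theorem inv_sqrt_max_le (n : ℕ) :
    1 / √((max n 1 : ℕ) : ℝ) ≤ 3 * √((n : ℝ) + 1) - 3 * √n := by
  rcases Nat.eq_zero_or_pos n with rfl | hn
  · norm_num
  · rw [max_eq_left hn]
    have h1 : (1 : ℝ) ≤ n := by exact_mod_cast hn
    have hs : 0 < √(n : ℝ) := Real.sqrt_pos.2 (by linarith)
    have h2 : √((n : ℝ) + 1) ≤ 2 * √n := by
      rw [Real.sqrt_le_left (by positivity), mul_pow, Real.sq_sqrt (by positivity)]
      linarith
    rw [div_le_iff₀ hs]
    have h3 := Real.sq_sqrt (show (0 : ℝ) ≤ n by linarith)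
    have h4 := Real.sq_sqrt (show (0 : ℝ) ≤ n + 1 by linarith)
    have h5 : √(n : ℝ) ≤ √((n : ℝ) + 1) := Real.sqrt_le_sqrt (by linarith)
    nlinarith

/-- Each episode raises exactly one count per step, so the right side grows by at least the new
term. -/
theorem pathSum_inv_sqrt_visits_le (l : List (Episode S A B H)) :
    pathSum (fun l e => ∑ i : Fin H,
        1 / √((max (visits l i (e.traj.1 i).1 (e.traj.1 i).2) 1 : ℕ) : ℝ)) l ≤
      ∑ i : Fin H, ∑ x : S × (A × B), 3 * √(visits l i x.1 x.2 : ℝ) := by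
  classical
  induction l using List.reverseRecOn with
  | nil => simp [visits]
  | append_singleton l e ih =>
    rw [pathSum_concat]
    have key (i : Fin H) : ∑ x : S × (A × B), 3 * √(visits l i x.1 x.2 : ℝ) +
        1 / √((max (visits l i (e.traj.1 i).1 (e.traj.1 i).2) 1 : ℕ) : ℝ) ≤
        ∑ x : S × (A × B), 3 * √(visits (l ++ [e]) i x.1 x.2 : ℝ) := by
      rw [← Finset.add_sum_erase _ _ (Finset.mem_univ (e.traj.1 i)),
        ← Finset.add_sum_erase _ (fun x : S × (A × B) => 3 * √(visits (l ++ [e]) i x.1 x.2 : ℝ))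
          (Finset.mem_univ (e.traj.1 i))]
      have h1 : ∑ x ∈ Finset.univ.erase (e.traj.1 i), 3 * √(visits (l ++ [e]) i x.1 x.2 : ℝ) =
          ∑ x ∈ Finset.univ.erase (e.traj.1 i), 3 * √(visits l i x.1 x.2 : ℝ) := by
        refine Finset.sum_congr rfl fun x hx => ?_
        rw [visits_concat, if_neg (Finset.ne_of_mem_erase hx).symm, add_zero]
      rw [h1, visits_concat, if_pos rfl]
      push_cast
      have := inv_sqrt_max_le (visits l i (e.traj.1 i).1 (e.traj.1 i).2)
      push_cast at this
      linarith
    have := Finset.sum_le_sum fun i (_ : i ∈ Finset.univ) => key i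
    rw [Finset.sum_add_distrib] at this
    linarith

/-- Cauchy–Schwarz, as the visits at a given step add up to the number of episodes. -/
theorem sum_sqrt_visits_le (l : List (Episode S A B H)) (i : Fin H) :
    ∑ x : S × (A × B), √(visits l i x.1 x.2 : ℝ) ≤
      √(Fintype.card S * Fintype.card (A × B) * l.length) := by
  refine Real.le_sqrt_of_sq_le (sq_sum_le_card_mul_sum_sq.trans (le_of_eq ?_))
  have h (x : S × (A × B)) : √(visits l i x.1 x.2 : ℝ) ^ 2 = (visits l i x.1 x.2 : ℝ) :=
    Real.sq_sqrt (Nat.cast_nonneg _)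
  simp only [h]
  rw [← Nat.cast_sum, sum_visits, Finset.card_univ, Fintype.card_prod]
  push_cast
  ring

theorem bonus_eq (K : ℕ) (δ c : ℝ) (n : ℕ) :
    bonus S A B H K δ c n = H * √(c * Fintype.card S * logFactor S A B H K δ) *
      (1 / √((max n 1 : ℕ) : ℝ)) := by
  rw [bonus, Real.sqrt_div' _ (Nat.cast_nonneg _)]
  ring

theorem bonus_nonneg (K : ℕ) (δ c : ℝ) (n : ℕ) : 0 ≤ bonus S A B H K δ c n := by
  unfold bonus
  positivity

theorem bonus_le (K : ℕ) (δ c : ℝ) (n : ℕ) :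
    bonus S A B H K δ c n ≤ H * √(c * Fintype.card S * logFactor S A B H K δ) := by
  rw [bonus_eq]
  refine mul_le_of_le_one_right (by positivity) ?_
  have h1 : (1 : ℝ) ≤ (max n 1 : ℕ) := by exact_mod_cast le_max_right _ _
  rw [div_le_one (Real.sqrt_pos.2 (by linarith))]
  exact Real.one_le_sqrt.2 h1

theorem pathSum_bonus_le (K : ℕ) (δ c : ℝ) (l : List (Episode S A B H)) :
    pathSum (fun l e => ∑ i : Fin H,
        bonus S A B H K δ c (visits l i (e.traj.1 i).1 (e.traj.1 i).2)) l ≤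
      3 * (H : ℝ) ^ 2 * √(c * Fintype.card S * logFactor S A B H K δ) *
        √(Fintype.card S * Fintype.card (A × B) * l.length) := by
  simp only [bonus_eq, ← Finset.mul_sum]
  rw [pathSum_const_mul]
  have h1 : ∑ i : Fin H, ∑ x : S × (A × B), 3 * √(visits l i x.1 x.2 : ℝ) ≤
      H * (3 * √(Fintype.card S * Fintype.card (A × B) * l.length)) := by
    calc ∑ i : Fin H, ∑ x : S × (A × B), 3 * √(visits l i x.1 x.2 : ℝ)
        ≤ ∑ i : Fin H, 3 * √(Fintype.card S * Fintype.card (A × B) * l.length) := by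
          refine Finset.sum_le_sum fun i _ => ?_
          rw [← Finset.mul_sum]
          exact mul_le_mul_of_nonneg_left (sum_sqrt_visits_le l i) (by norm_num)
      _ = _ := by simp
  calc _ ≤ H * √(c * Fintype.card S * logFactor S A B H K δ) *
        (H * (3 * √(Fintype.card S * Fintype.card (A × B) * l.length))) :=
        mul_le_mul_of_nonneg_left ((pathSum_inv_sqrt_visits_le l).trans h1) (by positivity)
    _ = _ := by ring

end Pigeonhole

/-! ### The Azuma–Hoeffding inequality. -/

section Martingale

variable {S A B : Type*} {H : ℕ} {G : Game S A B H}
    {learner : List (Episode S A B H) → PMF (MaxPolicy S A B H)}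
    {opponent : List (Episode S A B H) → MinPolicy S A B H}

/-- The Azuma–Hoeffding inequality along the transcript, at a fixed time `k`. -/
theorem playLaw_azuma {g : List (Episode S A B H) → Episode S A B H → ℝ}
    {m : List (Episode S A B H) → ℝ} {M : ℝ} (hM : 0 < M) (hg : ∀ l e, g l e ∈ Set.Icc 0 M)
    (hm : ∀ l, m l ∈ Set.Icc 0 M)
    (hmean : ∀ l, ENNReal.ofReal (m l) ≤
      expect (episodeLaw G learner opponent l) fun e => ENNReal.ofReal (g l e))
    {k K : ℕ} (hk : k ≤ K) (hk0 : 0 < k) {x : ℝ} (hx : 0 ≤ x) :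
    (playLaw G learner opponent K).toOuterMeasure
      {l | 2 * M * √(k * x) < pathSum (fun l e => m l - g l e) (l.take k)} ≤
      ENNReal.ofReal (Real.exp (-(2 * x))) := by
  -- The optimal Chernoff parameter: at the threshold the linear term is `4 x` and the variance term
  -- at most `2 x`.
  set t := 2 * √(x / k) / M with ht
  have hk' : (0 : ℝ) < k := by exact_mod_cast hk0
  have ht0 : 0 ≤ t := by positivity
  refine le_trans (measure_mono ?_) (playLaw_le_pathSum_take_le
    (F := fun l e => t * (m l - g l e) - t ^ 2 * M ^ 2 / 2)
    (fun l => expect_exp_lower_le_one hM (hg l) (hm l) ht0 (hmean l)) hk (2 * x))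
  intro l hl
  simp only [Set.mem_ofPred_eq] at hl ⊢
  rw [pathSum_sub, pathSum_const_mul, pathSum_const]
  have hlen : ((l.take k).length : ℝ) ≤ k := by exact_mod_cast List.length_take_le _ _
  have htM : t ^ 2 * M ^ 2 = 4 * (x / k) := by
    rw [ht, div_pow, mul_pow, Real.sq_sqrt (by positivity)]
    field_simp
    ring
  have h1 : ((l.take k).length : ℝ) * (t ^ 2 * M ^ 2 / 2) ≤ 2 * x := by
    calc ((l.take k).length : ℝ) * (t ^ 2 * M ^ 2 / 2) ≤ k * (t ^ 2 * M ^ 2 / 2) := by gcongr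
      _ = 2 * x := by rw [htM]; field_simp; ring
  have h2 : t * (2 * M * √(k * x)) = 4 * x := by
    have h3 : √(x / k) * √(k * x) = x := by
      rw [← Real.sqrt_mul (by positivity)]
      have : x / k * (k * x) = x ^ 2 := by field_simp
      rw [this, Real.sqrt_sq hx]
    calc t * (2 * M * √(k * x)) = 4 * (√(x / k) * √(k * x)) := by rw [ht]; field_simp; ring
      _ = 4 * x := by rw [h3]
  have h4 := mul_le_mul_of_nonneg_left hl.le ht0
  linarith

end Martingale

/-! ### The regret against a finite class. -/

section RegretBound

theorem sum_bonus_mem_Icc {S A B : Type*} {H : ℕ} {β : ℕ → ℝ} {b : ℝ}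
    (hβ : ∀ n, β n ∈ Set.Icc 0 b) (l : List (Episode S A B H))
    (t : Traj S A B H) :
    2 * ∑ i : Fin H, β (visits l i (t.1 i).1 (t.1 i).2) ∈ Set.Icc 0 (2 * (H * b)) := by
  refine ⟨mul_nonneg zero_le_two (Finset.sum_nonneg fun i _ => (hβ _).1),
    mul_le_mul_of_nonneg_left ?_ zero_le_two⟩
  refine (Finset.sum_le_sum fun i _ => (hβ _).2).trans (le_of_eq ?_)
  simp

variable {S A B : Type*} {H : ℕ} [Fintype S] [Fintype A] [Fintype B]

/-- The value of an episode plus twice the bonuses that are collected in it. -/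
def boostedValue (G : Game S A B H) (β : ℕ → ℝ) (l : List (Episode S A B H))
    (e : Episode S A B H) : ℝ :=
  value G e.μ e.ν + 2 * ∑ i : Fin H, β (visits l i (e.traj.1 i).1 (e.traj.1 i).2)

/-- The conditional mean of `boostedValue` given the past `l`. -/
def meanBoostedValue (G : Game S A B H) (Φ : Finset (MaxPolicy S A B H)) (η β : ℕ → ℝ)
    (opponent : List (Episode S A B H) → MinPolicy S A B H) (l : List (Episode S A B H)) : ℝ :=
  ∑ μ : Φ, expWeight (η (l.length + 1)) (fun μ : Φ => cumulativeGain G.init G.r β l μ) μ *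
    (value G μ (opponent l) + mean (trajLaw G μ (opponent l)) fun t =>
      2 * ∑ i : Fin H, β (visits l i (t.1 i).1 (t.1 i).2))

variable {G : Game S A B H} {Φ : Finset (MaxPolicy S A B H)} {η β : ℕ → ℝ}
  {opponent : List (Episode S A B H) → MinPolicy S A B H}

theorem boostedValue_mem_Icc {b : ℝ} (hβ : ∀ n, β n ∈ Set.Icc 0 b) (l : List (Episode S A B H))
    (e : Episode S A B H) : boostedValue G β l e ∈ Set.Icc 0 (H + 2 * (H * b)) := by
  have h1 := sum_bonus_mem_Icc hβ l e.traj
  have h2 := value_mem_Icc (G := G) (μ := e.μ) (ν := e.ν)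
  exact ⟨add_nonneg h2.1 h1.1, add_le_add h2.2 h1.2⟩

theorem meanBoostedValue_mem_Icc (hΦ : Φ.Nonempty) {b : ℝ} (hβ : ∀ n, β n ∈ Set.Icc 0 b)
    (l : List (Episode S A B H)) :
    meanBoostedValue G Φ η β opponent l ∈ Set.Icc 0 (H + 2 * (H * b)) := by
  have : Nonempty Φ := hΦ.to_subtype
  have key (μ : MaxPolicy S A B H) : (value G μ (opponent l) + mean (trajLaw G μ (opponent l))
      fun t => 2 * ∑ i : Fin H, β (visits l i (t.1 i).1 (t.1 i).2)) ∈
        Set.Icc 0 (H + 2 * (H * b)) := by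
    have h2 := value_mem_Icc (G := G) (μ := μ) (ν := opponent l)
    exact ⟨add_nonneg h2.1 (mean_nonneg fun t => (sum_bonus_mem_Icc hβ l t).1),
      add_le_add h2.2 (mean_le fun t => (sum_bonus_mem_Icc hβ l t).2)⟩
  unfold meanBoostedValue
  refine ⟨Finset.sum_nonneg fun μ _ => mul_nonneg (expWeight_nonneg _ _ _) (key μ).1, ?_⟩
  refine (Finset.sum_le_sum fun (μ : Φ) _ => mul_le_mul_of_nonneg_left (key μ).2
    (expWeight_nonneg (η (l.length + 1)) (fun μ : Φ => cumulativeGain G.init G.r β l μ) μ)).trans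
    (le_of_eq ?_)
  rw [← Finset.sum_mul, sum_expWeight, one_mul]

/-- Averages over the draw of the policy and that of the trajectory together, so one martingale
covers both sources of noise. The opponent's policy is fixed by `l`. -/
theorem expect_boostedValue (hΦ : Φ.Nonempty) (hβ : ∀ n, 0 ≤ β n) (l : List (Episode S A B H)) :
    expect (episodeLaw G (opExp3 G.init G.r Φ hΦ η β) opponent l)
        (fun e => ENNReal.ofReal (boostedValue G β l e)) =
      ENNReal.ofReal (meanBoostedValue G Φ η β opponent l) := by
  have hb (t : Traj S A B H) : 0 ≤ 2 * ∑ i : Fin H, β (visits l i (t.1 i).1 (t.1 i).2) :=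
    mul_nonneg zero_le_two (Finset.sum_nonneg fun i _ => hβ _)
  have hv (μ : MaxPolicy S A B H) : 0 ≤ value G μ (opponent l) := value_mem_Icc.1
  unfold episodeLaw
  rw [expect_bind, expect_opExp3, meanBoostedValue, ENNReal.ofReal_sum_of_nonneg
    fun μ _ => mul_nonneg (expWeight_nonneg _ _ _) (add_nonneg (hv _) (mean_nonneg hb))]
  refine Finset.sum_congr rfl fun μ _ => ?_
  rw [ENNReal.ofReal_mul (expWeight_nonneg _ _ _), expect_map]
  congr 1
  unfold boostedValue
  rw [expect_ofReal _ fun t => add_nonneg (hv _) (hb t), mean_add]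
  congr 2
  exact mean_const (trajLaw G μ (opponent l)) (value G μ (opponent l))

theorem weightedGain_le_meanBoostedValue (hβ : ∀ n, 0 ≤ β n) {l : List (Episode S A B H)}
    (hl : IsAccurate G β l) {e : Episode S A B H} (he : e.ν = opponent l) :
    weightedGain G.init G.r Φ η β l e ≤ meanBoostedValue G Φ η β opponent l := by
  refine Finset.sum_le_sum fun μ _ => mul_le_mul_of_nonneg_left ?_ (expWeight_nonneg _ _ _)
  rw [he]
  exact ucbValue_le hβ hl

/-- The regret decomposition of OP-EXP3 on a transcript with accurate counters. -/
theorem sum_value_sub_le (hΦ : Φ.Nonempty) (hβ : ∀ n, 0 ≤ β n) (hH : 0 < H) {a : ℝ} (ha : 0 < a)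
    {l : List (Episode S A B H)} (hcons : IsConsistent opponent l)
    (hacc : ∀ t < l.length, IsAccurate G β (l.take t)) {μ : MaxPolicy S A B H} (hμ : μ ∈ Φ) :
    (l.map fun e => value G μ e.ν - value G e.μ e.ν).sum ≤
      (2 / a + a) * √((H : ℝ) ^ 2 * Real.log Φ.card * l.length) +
      pathSum (fun l e => meanBoostedValue G Φ (rate Φ a) β opponent l - boostedValue G β l e) l +
      2 * pathSum (fun l e => ∑ i : Fin H, β (visits l i (e.traj.1 i).1 (e.traj.1 i).2)) l := by
  have h1 : pathSum (fun _ e => value G μ e.ν) l ≤ cumulativeGain G.init G.r β l μ :=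
    pathSum_le_pathSum (F' := fun l e => ucbValue G.init G.r β l μ e.ν)
      fun t => value_le_ucbValue (hacc t t.isLt)
  have h2 := cumulativeGain_le (init := G.init) hΦ (fun h s a => (G.r_mem h s a).1) hβ hH ha l hμ
  have h3 : pathSum (weightedGain G.init G.r Φ (rate Φ a) β) l ≤
      pathSum (fun l _ => meanBoostedValue G Φ (rate Φ a) β opponent l) l :=
    pathSum_le_pathSum fun t => weightedGain_le_meanBoostedValue hβ (hacc t t.isLt) (hcons t)
  have h4 : pathSum (boostedValue G β) l = pathSum (fun _ e => value G e.μ e.ν) l +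
      2 * pathSum (fun l e => ∑ i : Fin H, β (visits l i (e.traj.1 i).1 (e.traj.1 i).2)) l := by
    rw [← pathSum_const_mul, ← pathSum_add]
    rfl
  rw [← pathSum_of_past_free, pathSum_sub, pathSum_sub, h4]
  linarith

theorem sqrt_le_two_mul {x : ℝ} (hx : 1 / 2 ≤ x) : √x ≤ 2 * x := by
  rw [Real.sqrt_le_left (by linarith)]
  nlinarith

/-- The Azuma deviation, whose range includes the maximal bonuses, contributes `4 + 4 √c`; the
collected bonuses contribute `12 √c`. The spare factors `√x` are removed by `√x ≤ 2 x`. -/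
theorem deviation_add_bonus_le {h s A k c x : ℝ} (hh : 1 ≤ h) (hs : 1 ≤ s) (hA : 1 ≤ A)
    (hk : 0 ≤ k) (hc : 0 ≤ c) (hx : 1 / 2 ≤ x) :
    2 * (h + 2 * (h * (h * √(c * s * x)))) * √(k * x) +
        2 * (3 * h ^ 2 * √(c * s * x) * √(s * A * k)) ≤
      (4 + 16 * √c) * (√(h ^ 4 * s ^ 2 * A * k) * x) := by
  have hs0 : 0 ≤ s := by linarith
  have hA0 : 0 ≤ A := by linarith
  have hx0 : 0 ≤ x := by linarith
  have e1 : √(c * s * x) = √c * √s * √x := by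
    rw [Real.sqrt_mul (by positivity), Real.sqrt_mul hc]
  have e2 : √(k * x) = √k * √x := Real.sqrt_mul hk _
  have e3 : √(s * A * k) = √s * √A * √k := by
    rw [Real.sqrt_mul (by positivity), Real.sqrt_mul hs0]
  have e4 : √(h ^ 4 * s ^ 2 * A * k) = h ^ 2 * s * √A * √k := by
    rw [Real.sqrt_mul (by positivity), Real.sqrt_mul (by positivity),
      show h ^ 4 * s ^ 2 = (h ^ 2 * s) ^ 2 by ring, Real.sqrt_sq (by positivity)]
  have hxx : √x * √x = x := Real.mul_self_sqrt hx0
  have hss : √s * √s = s := Real.mul_self_sqrt hs0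
  have hx2 := sqrt_le_two_mul hx
  have hs1 : 1 ≤ √s := Real.one_le_sqrt.2 hs
  have hA1 : 1 ≤ √A := Real.one_le_sqrt.2 hA
  have hss' : √s ≤ s := by nlinarith
  rw [e1, e2, e3, e4]
  have i1 : 2 * h * (√k * √x) ≤ 4 * (h ^ 2 * s * √A * √k * x) := by
    have : h * 1 * 1 ≤ h ^ 2 * s * √A := by
      gcongr
      nlinarith
    calc 2 * h * (√k * √x) = 2 * (h * 1 * 1) * √k * √x := by ring
      _ ≤ 2 * (h ^ 2 * s * √A) * √k * (2 * x) := by gcongr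
      _ = _ := by ring
  have i2 : 4 * h ^ 2 * (√c * √s * √x) * (√k * √x) ≤ 4 * √c * (h ^ 2 * s * √A * √k * x) := by
    calc 4 * h ^ 2 * (√c * √s * √x) * (√k * √x) = 4 * √c * (h ^ 2 * √s * 1 * √k * (√x * √x)) := by
          ring
      _ = 4 * √c * (h ^ 2 * √s * 1 * √k * x) := by rw [hxx]
      _ ≤ 4 * √c * (h ^ 2 * s * √A * √k * x) := by gcongr
  have i3 : 6 * h ^ 2 * (√c * √s * √x) * (√s * √A * √k) ≤ 12 * √c * (h ^ 2 * s * √A * √k * x) := by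
    calc 6 * h ^ 2 * (√c * √s * √x) * (√s * √A * √k)
        = 6 * √c * (h ^ 2 * (√s * √s) * √A * √k * √x) := by ring
      _ = 6 * √c * (h ^ 2 * s * √A * √k * √x) := by rw [hss]
      _ ≤ 6 * √c * (h ^ 2 * s * √A * √k * (2 * x)) := by gcongr
      _ = _ := by ring
  linarith

theorem nat_mul_exp_neg_logFactor_le {K : ℕ} {δ : ℝ} (hδ : 0 < δ) (hδ1 : δ ≤ 1)
    (hQ : 2 ≤ (K : ℝ) * H * Fintype.card S * Fintype.card (A × B)) :
    K * Real.exp (-(2 * logFactor S A B H K δ)) ≤ δ / 2 := by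
  have h1 : Real.exp (-(2 * logFactor S A B H K δ)) =
      Real.exp (-logFactor S A B H K δ) * Real.exp (-logFactor S A B H K δ) := by
    rw [← Real.exp_add]; ring_nf
  rw [h1, exp_neg_logFactor hδ hQ]
  set Q : ℝ := (K : ℝ) * H * Fintype.card S * Fintype.card (A × B) with hQdef
  have hKQ : (K : ℝ) ≤ Q := by
    have h0 : (0 : ℝ) < K * (H * Fintype.card S * Fintype.card (A × B) : ℕ) := by
      push_cast; rw [hQdef] at hQ; nlinarith
    have h2 : 1 ≤ H * Fintype.card S * Fintype.card (A × B) :=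
      Nat.one_le_iff_ne_zero.2 fun h => by rw [h] at h0; simp at h0
    have h3 : (1 : ℝ) ≤ (H * Fintype.card S * Fintype.card (A × B) : ℕ) := by exact_mod_cast h2
    push_cast at h3
    rw [hQdef]
    nlinarith [(Nat.cast_nonneg K : (0 : ℝ) ≤ K)]
  have hx1 : δ / Q ≤ 1 / 2 := by
    rw [div_le_div_iff₀ (by linarith) (by norm_num)]
    linarith
  calc K * (δ / Q * (δ / Q)) ≤ Q * (δ / Q * (1 / 2)) := by gcongr
    _ = δ / 2 := by field_simp

/-- The regret of OP-EXP3 against each policy of its class, with high probability. -/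
theorem playLaw_opExp3_regret (hΦ : Φ.Nonempty) {K : ℕ} {δ a c : ℝ} (hH : 1 ≤ H)
    (hδ : 0 < δ) (hδ1 : δ < 1) (ha : 0 < a) (hc : 8 ≤ c)
    (hQ : 2 ≤ (K : ℝ) * H * Fintype.card S * Fintype.card (A × B)) :
    ENNReal.ofReal (1 - δ) ≤ (playLaw G (opExp3 G.init G.r Φ hΦ (rate Φ a)
      (bonus S A B H K δ c)) opponent K).toOuterMeasure
      {l | ∀ k ≤ K, ∀ μ ∈ Φ,
        ((l.take k).map fun e => value G μ e.ν - value G e.μ e.ν).sum ≤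
          (4 + 16 * √c) * (√((H : ℝ) ^ 4 * (Fintype.card S : ℝ) ^ 2 * Fintype.card (A × B) * k)
            * logFactor S A B H K δ) +
          (2 / a + a) * √((H : ℝ) ^ 2 * Real.log Φ.card * k)} := by
  have : Nonempty S := ⟨G.init⟩
  have hι := half_le_logFactor hδ hδ1.le hQ
  set ι := logFactor S A B H K δ with hιdef
  set β := bonus S A B H K δ c with hβdef
  set b := (H : ℝ) * √(c * Fintype.card S * ι) with hb
  have hH1 : (1 : ℝ) ≤ H := by exact_mod_cast hH
  have hβ (n : ℕ) : β n ∈ Set.Icc 0 b := ⟨bonus_nonneg K δ c n, bonus_le K δ c n⟩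
  have hM : 0 < H + 2 * (H * b) := by
    have : 0 ≤ b := (hβ 0).1.trans (hβ 0).2
    positivity
  set m := meanBoostedValue G Φ (rate Φ a) β opponent with hmdef
  set F₁ : Set (List (Episode S A B H)) := {l | ∃ k < K, ¬ IsAccurate G β (l.take k)} with hF₁
  -- One deviation event for each time `j + 1`, since Azuma holds at fixed times only; time zero is
  -- trivial. Together these have probability at most `δ / 2`, as does `F₁`.
  let F₂ : Fin K → Set (List (Episode S A B H)) := fun j =>
    {l | 2 * (H + 2 * (H * b)) * √((j.val + 1 : ℕ) * ι) <
      pathSum (fun l e => m l - boostedValue G β l e) (l.take (j.val + 1))}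
  refine one_sub_le_toOuterMeasure (F := F₁ ∪ ⋃ j, F₂ j) hδ.le ?_ ?_
  · refine (measure_union_le _ _).trans ?_
    rw [← add_halves δ, ENNReal.ofReal_add (by positivity) (by positivity)]
    refine add_le_add (playLaw_not_isAccurate_le hδ hδ1.le hc hQ)
      ((measure_iUnion_fintype_le _ _).trans ?_)
    refine (Finset.sum_le_sum fun j _ => playLaw_azuma hM (boostedValue_mem_Icc hβ)
      (meanBoostedValue_mem_Icc hΦ hβ) (fun l => (expect_boostedValue hΦ (fun n => (hβ n).1) l).ge)
      (show j.val + 1 ≤ K from j.isLt) j.val.succ_pos (by linarith : 0 ≤ ι)).trans ?_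
    rw [Finset.sum_const, nsmul_eq_mul, Finset.card_univ, Fintype.card_fin,
      ← ENNReal.ofReal_natCast, ← ENNReal.ofReal_mul (Nat.cast_nonneg K)]
    exact ENNReal.ofReal_le_ofReal (nat_mul_exp_neg_logFactor_le hδ hδ1.le hQ)
  · intro l hl hlF k hk μ hμ
    obtain ⟨hlen, hcons⟩ := mem_support_playLaw hl
    simp only [Set.mem_union, Set.mem_iUnion, not_or, not_exists] at hlF
    rcases Nat.eq_zero_or_pos k with rfl | hk0
    · simp
    have hlk : (l.take k).length = k := by rw [List.length_take, hlen, min_eq_left hk]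
    have hacc (t : ℕ) (ht : t < (l.take k).length) : IsAccurate G β ((l.take k).take t) := by
      rw [hlk] at ht
      rw [List.take_take, min_eq_left ht.le]
      by_contra hcon
      exact hlF.1 ⟨t, ht.trans_le hk, hcon⟩
    have hdev : pathSum (fun l e => m l - boostedValue G β l e) (l.take k) ≤
        2 * (H + 2 * (H * b)) * √(k * ι) := by
      have := hlF.2 ⟨k - 1, by omega⟩
      simp only [F₂, Set.mem_ofPred_eq, not_lt, Nat.sub_add_cancel hk0] at this
      exact this
    have hreg := sum_value_sub_le hΦ (fun n => (hβ n).1) hH ha (hcons.take k) hacc hμ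
    have hbon := pathSum_bonus_le K δ c (l.take k)
    rw [hlk] at hreg hbon
    have hAB : (1 : ℝ) ≤ Fintype.card (A × B) := by
      have : Fintype.card (A × B) ≠ 0 := fun h => by rw [h] at hQ; norm_num at hQ
      exact_mod_cast Nat.one_le_iff_ne_zero.2 this
    have hfin := deviation_add_bonus_le (h := H) (s := Fintype.card S) (A := Fintype.card (A × B))
      (k := k) (c := c) (x := ι) hH1 (by exact_mod_cast Fintype.card_pos) hAB
      (Nat.cast_nonneg k) (by linarith) hι
    linarith

end RegretBound

/-! ### Reduction from Markov to deterministic Markov baselines. -/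

section MarkovPolicies

theorem mean_comm {α β : Type*} [Fintype α] [Fintype β] (p : PMF α) (q : PMF β)
    (f : α → β → ℝ) :
    mean p (fun x => mean q fun y => f x y) = mean q fun y => mean p fun x => f x y := by
  simp only [mean, Finset.mul_sum]
  rw [Finset.sum_comm]
  exact Finset.sum_congr rfl fun _ _ => Finset.sum_congr rfl fun _ _ => by ring

theorem mean_list_sum {α β : Type*} [Fintype α] (p : PMF α) (f : β → α → ℝ) (l : List β) :
    (l.map fun e => mean p (f e)).sum = mean p fun x => (l.map fun e => f e x).sum := by
  induction l with
  | nil => simp [mean_const]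
  | cons e l ih => simp only [List.map_cons, List.sum_cons, ih, mean_add]

theorem exists_mean_le {α : Type*} [Fintype α] [Nonempty α] (p : PMF α) (f : α → ℝ) :
    ∃ x, mean p f ≤ f x := by
  obtain ⟨x, hx⟩ := Finite.exists_max f
  exact ⟨x, mean_le hx⟩

theorem log_card_detMarkovPolicies_le {S A B : Type*} {H : ℕ} [Fintype S] [Fintype A]
    [Nonempty A] :
    Real.log (detMarkovPolicies S A B H).card ≤
      H * Fintype.card S * Real.log (Fintype.card A) := by
  have h1 : (detMarkovPolicies S A B H).card ≤ Fintype.card A ^ (H * Fintype.card S) := by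
    classical
    have hsurj : Set.SurjOn (fun (f : Fin H → S → A) h _ s => PMF.pure (f h s))
        (Finset.univ : Finset (Fin H → S → A))
        (detMarkovPolicies S A B H : Set (MaxPolicy S A B H)) := by
      intro μ hμ
      simp only [detMarkovPolicies, Finset.mem_coe, Finset.mem_image, Finset.mem_univ,
        true_and] at hμ
      obtain ⟨f, rfl⟩ := hμ
      exact ⟨f, by simp, rfl⟩
    refine (Finset.card_le_card_of_surjOn _ hsurj).trans (le_of_eq ?_)
    rw [Finset.card_univ, ← Nat.card_eq_fintype_card, Nat.card_fun, Nat.card_fun,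
      Nat.card_eq_fintype_card, Nat.card_eq_fintype_card, Nat.card_eq_fintype_card,
      Fintype.card_fin, ← pow_mul, mul_comm]
  have h2 : (0 : ℝ) < (detMarkovPolicies S A B H).card := by
    exact_mod_cast (detMarkovPolicies_nonempty S A B H).card_pos
  calc Real.log (detMarkovPolicies S A B H).card
      ≤ Real.log ((Fintype.card A : ℝ) ^ (H * Fintype.card S)) :=
        Real.log_le_log h2 (by exact_mod_cast h1)
    _ = _ := by rw [Real.log_pow]; push_cast; ring

variable {S A B : Type*} {H : ℕ} [Fintype S] [Fintype A] [Fintype B]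

/-- The policy with the action distribution `m (h, s)` at step `h` in state `s`. -/
def markovPolicy (m : Fin H × S → PMF A) : MaxPolicy S A B H := fun h _ s => m (h, s)

variable {G : Game S A B H} {ν : MinPolicy S A B H}

theorem returnFrom_congr {μ μ' : MaxPolicy S A B H} (ρ : Fin H → S → A × B → ℝ) {h : ℕ}
    (hμ : ∀ i : Fin H, h ≤ i.val → μ i = μ' i) (τ : Fin h → S × (A × B)) (s : S) :
    returnFrom G μ ν ρ h τ s = returnFrom G μ' ν ρ h τ s := by
  induction n : H - h generalizing h s with
  | zero => rw [returnFrom_of_le _ (by omega), returnFrom_of_le _ (by omega)]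
  | succ n ih =>
    have h' : h < H := by omega
    rw [returnFrom_of_lt _ h', returnFrom_of_lt _ h', hμ ⟨h, h'⟩ le_rfl]
    congr 1; funext a; congr 1; funext b; congr 2; funext s'
    exact ih (fun i hi => hμ i (by omega)) _ _ (by omega)

open Classical in
/-- The return is affine in the action distribution of a Markov policy at each step and state. -/
theorem returnFrom_update (m : Fin H × S → PMF A) (x : Fin H × S) (p : PMF A)
    (ρ : Fin H → S → A × B → ℝ) {h : ℕ} (τ : Fin h → S × (A × B)) (s : S) :
    returnFrom G (markovPolicy (Function.update m x p)) ν ρ h τ s = mean p fun a =>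
      returnFrom G (markovPolicy (Function.update m x (PMF.pure a))) ν ρ h τ s := by
  induction n : H - h generalizing h s with
  | zero =>
    have h' : H ≤ h := by omega
    simp only [returnFrom_of_le _ h', mean_const]
  | succ n ih =>
    have h' : h < H := by omega
    simp only [returnFrom_of_lt _ h']
    -- At the updated pair `p` enters only through the current action, because later steps never
    -- consult the distribution of step `h`. Elsewhere the current action law is unchanged and the
    -- average over `p` commutes with the others.
    by_cases hx : ((⟨h, h'⟩, s) : Fin H × S) = x
    · subst hx
      simp only [markovPolicy, Function.update_self, mean_pure]
      congr 1; funext a; congr 1; funext b; congr 2; funext s'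
      refine returnFrom_congr ρ (fun i hi => ?_) _ _
      funext τ' s''
      have hne : (i, s'') ≠ ((⟨h, h'⟩, s) : Fin H × S) := by
        intro heq
        have := congrArg (fun y : Fin H × S => y.1.val) heq
        simp only at this
        omega
      show Function.update m _ _ (i, s'') = Function.update m _ _ (i, s'')
      rw [Function.update_of_ne hne, Function.update_of_ne hne]
    · have hq (q : PMF A) : markovPolicy (B := B) (Function.update m x q) ⟨h, h'⟩ τ s =
          m (⟨h, h'⟩, s) := by
        show Function.update m _ _ (_, s) = _
        rw [Function.update_of_ne hx]
      simp only [hq]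
      rw [mean_comm p]
      congr 1; funext a
      rw [mean_comm p]
      congr 1; funext b
      rw [mean_add, mean_const, mean_comm p]
      congr 2; funext s'
      exact ih _ _ (by omega)

open Classical in
-- Round one coordinate at a time: an affine function of a distribution is at most its value at some
-- pure action. The sum over episodes is taken first, so one action serves all opponents.
theorem exists_deterministic_sum_value_le [Nonempty A] (l : List (Episode S A B H))
    (m : Fin H × S → PMF A) (T : Finset (Fin H × S)) :
    ∃ m' : Fin H × S → PMF A, (∀ x ∈ T, ∃ a, m' x = PMF.pure a) ∧
      (l.map fun e => value G (markovPolicy m) e.ν).sum ≤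
        (l.map fun e => value G (markovPolicy m') e.ν).sum := by
  induction T using Finset.induction_on with
  | empty => exact ⟨m, by simp, le_rfl⟩
  | insert x T hx ih =>
    obtain ⟨m', h1, h2⟩ := ih
    obtain ⟨a, ha⟩ := exists_mean_le (m' x) fun a =>
      (l.map fun e => value G (markovPolicy (Function.update m' x (PMF.pure a))) e.ν).sum
    refine ⟨Function.update m' x (PMF.pure a), fun y hy => ?_, h2.trans (le_trans ?_ ha)⟩
    · by_cases hyx : y = x
      · subst hyx
        exact ⟨a, Function.update_self _ _ _⟩
      · rw [Function.update_of_ne hyx]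
        exact h1 y ((Finset.mem_insert.1 hy).resolve_left hyx)
    · rw [← mean_list_sum]
      refine le_of_eq (congrArg List.sum (List.map_congr_left fun e _ => ?_))
      simp only [value_eq_returnFrom]
      rw [← returnFrom_update, Function.update_eq_self]

/-- Against a finite sequence of opponents, no Markov policy beats all deterministic ones. -/
theorem exists_detMarkovPolicy_sum_value_le [Nonempty A] (l : List (Episode S A B H))
    {μ : MaxPolicy S A B H} (hμ : μ ∈ markovPolicies S A B H) :
    ∃ μ' ∈ detMarkovPolicies S A B H,
      (l.map fun e => value G μ e.ν).sum ≤ (l.map fun e => value G μ' e.ν).sum := by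
  obtain ⟨m, rfl⟩ := hμ
  obtain ⟨m', h1, h2⟩ := exists_deterministic_sum_value_le (G := G) l (fun x => m x.1 x.2)
    Finset.univ
  choose f hf using fun x => h1 x (Finset.mem_univ x)
  refine ⟨markovPolicy m', ?_, h2⟩
  simp only [detMarkovPolicies, Finset.mem_image, Finset.mem_univ, true_and]
  refine ⟨fun h s => f (h, s), ?_⟩
  funext h τ s
  exact (hf (h, s)).symm

/-- The class has log-cardinality at most `H S ι`, and `H ^ 3 S k ι` is dominated by the square of
the main term because `ι ≤ (2 ι) ^ 2`. -/
theorem sqrt_log_card_le [Nonempty S] [Nonempty A] [Nonempty B] {K k : ℕ} {δ : ℝ} (hH : 1 ≤ H)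
    (hK : 1 ≤ K) (hδ : 0 < δ) (hδ1 : δ ≤ 1)
    (hQ : 2 ≤ (K : ℝ) * H * Fintype.card S * Fintype.card (A × B)) :
    √((H : ℝ) ^ 2 * Real.log (detMarkovPolicies S A B H).card * k) ≤
      2 * (√((H : ℝ) ^ 4 * (Fintype.card S : ℝ) ^ 2 * Fintype.card (A × B) * k) *
        logFactor S A B H K δ) := by
  have hι := half_le_logFactor hδ hδ1 hQ
  have hlogA : Real.log (Fintype.card A) ≤ logFactor S A B H K δ := by
    refine Real.log_le_log (by exact_mod_cast Fintype.card_pos) ?_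
    have h1 : Fintype.card A ≤ K * H * Fintype.card S * Fintype.card (A × B) := by
      rw [Fintype.card_prod]
      have := Fintype.card_pos (α := S)
      have := Fintype.card_pos (α := B)
      calc Fintype.card A = 1 * 1 * 1 * (Fintype.card A * 1) := by ring
        _ ≤ K * H * Fintype.card S * (Fintype.card A * Fintype.card B) := by gcongr <;> assumption
    rw [le_div_iff₀ hδ]
    have h2 : (Fintype.card A : ℝ) ≤ K * H * Fintype.card S * Fintype.card (A × B) := by
      exact_mod_cast h1
    exact (mul_le_of_le_one_right (Nat.cast_nonneg _) hδ1).trans h2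
  set ι := logFactor S A B H K δ
  have hS1 : (1 : ℝ) ≤ Fintype.card S := by exact_mod_cast Fintype.card_pos
  have hAB : (1 : ℝ) ≤ Fintype.card (A × B) := by exact_mod_cast Fintype.card_pos
  have hH1 : (1 : ℝ) ≤ H := by exact_mod_cast hH
  have hN : Real.log (detMarkovPolicies S A B H).card ≤ H * Fintype.card S * ι :=
    log_card_detMarkovPolicies_le.trans (mul_le_mul_of_nonneg_left hlogA (by positivity))
  have e : 2 * (√((H : ℝ) ^ 4 * (Fintype.card S : ℝ) ^ 2 * Fintype.card (A × B) * k) * ι) =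
      √((H : ℝ) ^ 4 * (Fintype.card S : ℝ) ^ 2 * Fintype.card (A × B) * k * (2 * ι) ^ 2) := by
    rw [Real.sqrt_mul' _ (sq_nonneg (2 * ι)), Real.sqrt_sq (by linarith)]
    ring
  rw [e]
  refine Real.sqrt_le_sqrt ?_
  have hι2 : ι ≤ (2 * ι) ^ 2 := by nlinarith
  calc (H : ℝ) ^ 2 * Real.log (detMarkovPolicies S A B H).card * k
      ≤ (H : ℝ) ^ 2 * (H * Fintype.card S * ι) * k := by gcongr
    _ = (H : ℝ) ^ 3 * (Fintype.card S) ^ 1 * 1 * k * ι := by ring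
    _ ≤ (H : ℝ) ^ 4 * (Fintype.card S : ℝ) ^ 2 * Fintype.card (A × B) * k * (2 * ι) ^ 2 := by
      gcongr <;> first | assumption | norm_num

end MarkovPolicies

/-! ### The degenerate case and the opponent's private seed. -/

section Main

variable {S A B : Type*} {H : ℕ}

theorem subsingleton_pmf [Subsingleton A] : Subsingleton (PMF A) := by
  refine ⟨fun p q => PMF.ext fun x => ?_⟩
  have h (p : PMF A) : p x = 1 := by
    rw [PMF.apply_eq_one_iff]
    obtain ⟨y, hy⟩ := p.support_nonempty
    refine Set.Subset.antisymm (fun z _ => Subsingleton.elim _ _) ?_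
    rintro z rfl
    rwa [Subsingleton.elim z y]
  rw [h p, h q]

variable [Fintype S] [Fintype A] [Fintype B]

theorem regret_le_of_forall {G : Game S A B H} {Φ : Set (MaxPolicy S A B H)} (hΦ : Φ.Nonempty)
    {l : List (Episode S A B H)} {x : ℝ}
    (h : ∀ μ ∈ Φ, (l.map fun e => value G μ e.ν - value G e.μ e.ν).sum ≤ x) :
    regret G Φ l ≤ x := by
  refine csSup_le (hΦ.image _) ?_
  rintro _ ⟨μ, hμ, rfl⟩
  exact h μ hμ

theorem list_sum_map_sub {α : Type*} (f g : α → ℝ) (l : List α) :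
    (l.map fun e => f e - g e).sum = (l.map f).sum - (l.map g).sum := by
  induction l with
  | nil => simp
  | cons e l ih =>
    simp only [List.map_cons, List.sum_cons, ih]
    ring

theorem regret_of_subsingleton [Subsingleton A] {G : Game S A B H}
    {Φ : Set (MaxPolicy S A B H)} (hΦ : Φ.Nonempty) (l : List (Episode S A B H)) :
    regret G Φ l ≤ 0 := by
  have : Subsingleton (PMF A) := subsingleton_pmf
  refine regret_le_of_forall hΦ fun μ _ => le_of_eq ?_
  have h (e : Episode S A B H) : e.μ = μ := by
    funext i τ s
    exact Subsingleton.elim _ _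
  simp [h]

theorem subsingleton_of_card_lt [Nonempty S] [Nonempty A] [Nonempty B] {K : ℕ} (hH : 1 ≤ H)
    (hK : 1 ≤ K) (hQ : ¬ 2 ≤ (K : ℝ) * H * Fintype.card S * Fintype.card (A × B)) :
    Subsingleton A := by
  rw [← Fintype.card_le_one_iff_subsingleton]
  by_contra hA
  refine hQ ?_
  rw [Fintype.card_prod]
  have h : 1 * 1 * 1 * (2 * 1) ≤
      K * H * Fintype.card S * (Fintype.card A * Fintype.card B) :=
    Nat.mul_le_mul (Nat.mul_le_mul (Nat.mul_le_mul hK hH) Fintype.card_pos)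
      (Nat.mul_le_mul (not_le.1 hA) Fintype.card_pos)
  exact_mod_cast h

theorem logFactor_nonneg [Nonempty S] [Nonempty A] [Nonempty B] {K : ℕ} {δ : ℝ} (hH : 1 ≤ H)
    (hK : 1 ≤ K) (hδ : 0 < δ) (hδ1 : δ ≤ 1) : 0 ≤ logFactor S A B H K δ := by
  refine Real.log_nonneg ?_
  rw [one_le_div hδ]
  have h : 1 * 1 * 1 * 1 ≤ K * H * Fintype.card S * Fintype.card (A × B) :=
    Nat.mul_le_mul (Nat.mul_le_mul (Nat.mul_le_mul hK hH) Fintype.card_pos) Fintype.card_pos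
  have h' : (1 : ℝ) ≤ K * H * Fintype.card S * Fintype.card (A × B) := by exact_mod_cast h
  linarith

/-- Given the seed, the opponent is a deterministic function of the transcript; a bound uniform in
the seed survives averaging. -/
theorem le_opExp3Prob {G : Game S A B H} {Φ : Finset (MaxPolicy S A B H)} {hΦ : Φ.Nonempty}
    {K : ℕ} {δ a c : ℝ} {Ω : Type*} [MeasurableSpace Ω] {P₀ : Measure Ω} [IsProbabilityMeasure P₀]
    {opponent : Ω → List (Episode S A B H) → MinPolicy S A B H}
    {E : Set (List (Episode S A B H))} {x : ENNReal}
    (h : ∀ ω, x ≤ (playLaw G (opExp3 G.init G.r Φ hΦ (rate Φ a) (bonus S A B H K δ c))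
      (opponent ω) K).toOuterMeasure E) :
    x ≤ opExp3Prob G Φ hΦ K δ a c P₀ opponent E := by
  calc x = ∫⁻ _, x ∂P₀ := by simp
    _ ≤ _ := lintegral_mono h

theorem one_sub_le_of_forall {α : Type*} {p : PMF α} {E : Set α} {δ : ℝ} (hδ : 0 ≤ δ)
    (h : ∀ x, x ∈ E) : ENNReal.ofReal (1 - δ) ≤ p.toOuterMeasure E :=
  one_sub_le_toOuterMeasure (F := ∅) hδ (by simp) fun x _ _ => h x

end Main

end MG

end

theorem mainTheorem1 :
    ∃ c₀ : ℝ, 0 < c₀ ∧ ∀ c : ℝ, c₀ ≤ c → ∀ a : ℝ, 0 < a → ∃ C : ℝ, 0 < C ∧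
      ∀ (S A B : Type*) [Fintype S] [Fintype A] [Fintype B] [Nonempty A] [Nonempty B]
        (H K : ℕ), 1 ≤ H → 1 ≤ K → ∀ δ : ℝ, 0 < δ → δ < 1 →
      ∀ (G : MG.Game S A B H)
        (Ω : Type*) [MeasurableSpace Ω] (P₀ : MeasureTheory.Measure Ω)
        [MeasureTheory.IsProbabilityMeasure P₀]
        (opponent : Ω → List (MG.Episode S A B H) → MG.MinPolicy S A B H),
      -- any finite baseline class of general policies
      (∀ (Φ : Finset (MG.MaxPolicy S A B H)) (hΦ : Φ.Nonempty),
        ENNReal.ofReal (1 - δ) ≤ MG.opExp3Prob G Φ hΦ K δ a c P₀ opponent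
          {l | ∀ k ≤ K, MG.regret G (Φ : Set (MG.MaxPolicy S A B H)) (l.take k) ≤
            C * (√((H : ℝ) ^ 4 * (Fintype.card S : ℝ) ^ 2 * Fintype.card (A × B) * k)
                  * MG.logFactor S A B H K δ
                + √((H : ℝ) ^ 2 * Real.log Φ.card * k))}) ∧
      -- all Markov policies as baseline
      ENNReal.ofReal (1 - δ) ≤ MG.opExp3Prob G (MG.detMarkovPolicies S A B H)
          (MG.detMarkovPolicies_nonempty S A B H) K δ a c P₀ opponent
          {l | ∀ k ≤ K, MG.regret G (MG.markovPolicies S A B H) (l.take k) ≤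
            C * (√((H : ℝ) ^ 4 * (Fintype.card S : ℝ) ^ 2 * Fintype.card (A × B) * k)
                  * MG.logFactor S A B H K δ)} := by
  -- The threshold `8` comes from the union bound over sets of states. The factor `2` before `2 / a
  -- + a` is needed for Markov baselines, where the exponential-weights term is at most twice the
  -- main term.
  refine ⟨8, by norm_num, fun c hc a ha => ⟨4 + 16 * √c + 2 * (2 / a + a), by positivity, ?_⟩⟩
  intro S A B _ _ _ _ _ H K hH hK δ hδ hδ1 G Ω _ P₀ _ opponent
  have : Nonempty S := ⟨G.init⟩
  have hι := MG.logFactor_nonneg (S := S) (A := A) (B := B) hH hK hδ hδ1.le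
  have ha' : 0 < 2 / a + a := by positivity
  have hc' : 0 ≤ √c := Real.sqrt_nonneg c
  have hmarkov : (MG.markovPolicies S A B H).Nonempty :=
    ⟨fun _ _ _ => PMF.pure (Classical.arbitrary A), fun _ _ => PMF.pure (Classical.arbitrary A), rfl⟩
  by_cases hQ : 2 ≤ (K : ℝ) * H * Fintype.card S * Fintype.card (A × B)
  · refine ⟨fun Φ hΦ => MG.le_opExp3Prob fun ω => ?_, MG.le_opExp3Prob fun ω => ?_⟩
    · refine (MG.playLaw_opExp3_regret hΦ hH hδ hδ1 ha hc hQ).trans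
        (MeasureTheory.measure_mono ?_)
      intro l hl k hk
      refine MG.regret_le_of_forall hΦ fun μ hμ => (hl k hk μ hμ).trans ?_
      have h1 : 0 ≤ √((H : ℝ) ^ 4 * (Fintype.card S : ℝ) ^ 2 * Fintype.card (A × B) * k)
        * MG.logFactor S A B H K δ := by positivity
      have h2 : 0 ≤ √((H : ℝ) ^ 2 * Real.log Φ.card * k) := Real.sqrt_nonneg _
      rw [mul_add]
      refine add_le_add ?_ ?_
      · exact mul_le_mul_of_nonneg_right (by linarith) h1
      · exact mul_le_mul_of_nonneg_right (by linarith) h2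
    · refine (MG.playLaw_opExp3_regret (MG.detMarkovPolicies_nonempty S A B H) hH hδ hδ1 ha hc
        hQ).trans (MeasureTheory.measure_mono ?_)
      intro l hl k hk
      refine MG.regret_le_of_forall hmarkov fun μ hμ => ?_
      obtain ⟨μ', hμ', hle⟩ := MG.exists_detMarkovPolicy_sum_value_le (G := G) (l.take k) hμ
      have h1 := hl k hk μ' hμ'
      have h2 := MG.sqrt_log_card_le (S := S) (A := A) (B := B) (k := k) hH hK hδ hδ1.le hQ
      rw [MG.list_sum_map_sub] at h1 ⊢
      have h3 := mul_le_mul_of_nonneg_left h2 ha'.le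
      linarith
  · have := MG.subsingleton_of_card_lt (S := S) (A := A) (B := B) hH hK hQ
    refine ⟨fun Φ hΦ => MG.le_opExp3Prob fun ω => MG.one_sub_le_of_forall hδ.le fun l k hk => ?_,
      MG.le_opExp3Prob fun ω => MG.one_sub_le_of_forall hδ.le fun l k hk => ?_⟩
    · refine (MG.regret_of_subsingleton hΦ _).trans (by positivity)
    · refine (MG.regret_of_subsingleton hmarkov _).trans (by positivity)
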